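/- Let $p\ge 1$ be odd, $r\ge 1$ and $V=p\cdot 2^r$. The binary graph on the vertices $\{0,\dots,V-1\}$ has a bond $(i,j)$ iff $j\equiv 2i$ or $j\equiv 2i+1 \pmod V$; every vertex then has two incoming and two outgoing bonds. Let the bonds $b$ have positive lengths $L_b$ that are incommensurate (linearly independent over $\mathbb{Q}$). Number the two incoming and the two outgoing bonds at every vertex in any way, and let $\boldsymbol\Sigma$ be the bond scattering matrix: $\boldsymbol\Sigma_{b',b}=0$ if the terminus of $b$ is not the origin of $b'$, and otherwise $\boldsymbol\Sigma_{b',b}$ is the entry of $\frac{1}{\sqrt2}\begin{pmatrix}1&1\\1&-1\end{pmatrix}$ in the row numbered by $b'$ and the column numbered by $b$. A periodic orbit $\gamma=(b_1,\dots,b_m)$, $m\ge1$, is a closed path up to cyclic rotation; it is primitive if it is not a repetition of a shorter one. A primitive pseudo orbit $\bar\gamma$ is a finite set of distinct primitive periodic orbits; $m_{\bar\gamma}$ is the number of its orbits, $B_{\bar\gamma}$ its total number of bonds, $L_{\bar\gamma}$ its total length, and $A_{\bar\gamma}=\prod_{\gamma\in\bar\gamma}A_\gamma$ with $A_\gamma=\boldsymbol\Sigma_{b_1,b_m}\boldsymbol\Sigma_{b_m,b_{m-1}}\cdots\boldsymbol\Sigma_{b_2,b_1}$.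 Put $$C_{\bar\gamma}=\sum_{\bar\gamma'}(-1)^{m_{\bar\gamma}+m_{\bar\gamma'}}A_{\bar\gamma}\overline{A_{\bar\gamma'}},$$ where the sum runs over all primitive pseudo orbits $\bar\gamma'$ (including $\bar\gamma$ itself) with $B_{\bar\gamma'}=B_{\bar\gamma}$ and $L_{\bar\gamma'}=L_{\bar\gamma}$. A self-intersection of $\bar\gamma$, or $\ell$-encounter ($\ell\ge2$), is a sequence of consecutive vertices $(v_0,\dots,v_{\tilde n})$, $\tilde n\ge 0$, that appears exactly $\ell$ times in the orbits of $\bar\gamma$ (read periodically) and is such that the $\ell$ vertices that precede $v_0$ are not all equal and the $\ell$ vertices that follow $v_{\tilde n}$ are not all equal; its length is $\tilde n$. Let $\bar\gamma$ be a primitive pseudo orbit with $B_{\bar\gamma}=n$. 1. If $\bar\gamma$ has exactly $N\ge1$ self-intersections and all of them are $2$-encounters of length zero, then $C_{\bar\gamma}=2^{N-n}$. 2. If some self-intersection of $\bar\gamma$ has positive length or is an $\ell$-encounter with $\ell\ge3$, then $C_{\bar\gamma}=0$. -/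

import Mathlib

namespace BinaryGraph

/-- Adjacency in the binary graph on the vertices `0, …, V - 1`: there is a bond `(i, j)` iff
`j = 2i` or `j = 2i + 1` (when `i < V / 2`), resp. `j = 2i - V` or `j = 2i + 1 - V`
(when `V / 2 ≤ i`). -/
def Adj (V : ℕ) (i j : Fin V) : Prop :=
  if 2 * (i : ℕ) < V then (j : ℕ) = 2 * i ∨ (j : ℕ) = 2 * i + 1
  else (j : ℕ) + V = 2 * i ∨ (j : ℕ) + V = 2 * i + 1

/-- A bond is an ordered pair of vertices joined by the adjacency relation. -/
abbrev Bond (V : ℕ) : Type := {b : Fin V × Fin V // Adj V b.1 b.2}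

/-- The origin of a bond. -/
def origin {V : ℕ} (b : Bond V) : Fin V := b.1.1

/-- The terminus of a bond. -/
def terminus {V : ℕ} (b : Bond V) : Fin V := b.1.2

/-- A numbering, by the row and column indices of a `2 × 2` matrix, of the two incoming and of
the two outgoing bonds at every vertex. -/
structure BondNumbering (V : ℕ) where
  /-- the number of `b` among the bonds that are incoming at the terminus of `b` -/
  inIdx : Bond V → Fin 2
  /-- the number of `b` among the bonds that are outgoing at the origin of `b` -/
  outIdx : Bond V → Fin 2
  inIdx_inj : ∀ b c, terminus b = terminus c → inIdx b = inIdx c → b = c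
  outIdx_inj : ∀ b c, origin b = origin c → outIdx b = outIdx c → b = c

/-- The `2 × 2` discrete Fourier transform matrix, the scattering matrix of every vertex. -/
noncomputable def dft : Matrix (Fin 2) (Fin 2) ℂ :=
  ((1 / Real.sqrt 2 : ℝ) : ℂ) • !![1, 1; 1, -1]

/-- The bond scattering matrix; its entry at `(b', b)` is the amplitude for scattering from the
bond `b` to the bond `b'`. -/
noncomputable def bondScattering {V : ℕ} (ν : BondNumbering V) : Matrix (Bond V) (Bond V) ℂ :=
  Matrix.of fun b' b =>
    if terminus b = origin b' then dft (ν.outIdx b') (ν.inIdx b) else 0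

/-- A periodic orbit: a nonempty closed path, as a cyclic sequence of bonds. -/
def IsPeriodicOrbit {V : ℕ} (c : Cycle (Bond V)) : Prop :=
  c ≠ Cycle.nil ∧ c.Chain fun b b' => terminus b = origin b'

/-- A cyclic sequence is primitive if it is not a repetition of a shorter one. -/
def IsPrimitive {α : Type*} (c : Cycle α) : Prop :=
  ∀ (w : List α) (k : ℕ), 2 ≤ k → c ≠ (((List.replicate k w).flatten : List α) : Cycle α)

/-- A primitive pseudo orbit: a finite set of (distinct) primitive periodic orbits. -/
def IsPrimitivePseudoOrbit {V : ℕ} (γ : Finset (Cycle (Bond V))) : Prop :=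
  ∀ c ∈ γ, IsPeriodicOrbit c ∧ IsPrimitive c

/-- The topological length of a pseudo orbit: its number of bonds. -/
def topLength {V : ℕ} (γ : Finset (Cycle (Bond V))) : ℕ := ∑ c ∈ γ, c.length

/-- The metric length of a pseudo orbit, for the bond lengths `L`. -/
noncomputable def metricLength {V : ℕ} (L : Bond V → ℝ) (γ : Finset (Cycle (Bond V))) : ℝ :=
  ∑ c ∈ γ, (c.toMultiset.map L).sum

/-- The product of the entries `S b₂ b₁ * S b₃ b₂ * ⋯ * S b₁ bₙ` around `b₁, …, bₙ`. -/
def listAmplitude {β : Type*} (S : Matrix β β ℂ) (l : List β) : ℂ :=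
  (List.zipWith (fun b b' => S b' b) l (l.rotate 1)).prod

theorem listAmplitude_eq_of_isRotated {β : Type*} (S : Matrix β β ℂ) (l l' : List β)
    (h : l ~r l') : listAmplitude S l = listAmplitude S l' := by
  obtain ⟨k, rfl⟩ := h
  unfold listAmplitude
  rw [List.rotate_rotate, Nat.add_comm k 1, ← List.rotate_rotate,
    ← List.zipWith_rotate_distrib _ _ _ _ (by simp)]
  exact ((List.rotate_perm _ k).prod_eq).symm

/-- The stability amplitude of a periodic orbit. -/
def orbitAmplitude {β : Type*} (S : Matrix β β ℂ) (c : Cycle β) : ℂ :=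
  Quot.liftOn c (listAmplitude S) fun l l' h => listAmplitude_eq_of_isRotated S l l' h

/-- The stability amplitude of a pseudo orbit. -/
noncomputable def amplitude {V : ℕ} (ν : BondNumbering V) (γ : Finset (Cycle (Bond V))) : ℂ :=
  ∏ c ∈ γ, orbitAmplitude (bondScattering ν) c

/-- The partners of `γ`: all primitive pseudo orbits with the topological and the metric length
of `γ`. -/
def partners {V : ℕ} (L : Bond V → ℝ) (γ : Finset (Cycle (Bond V))) :
    Set (Finset (Cycle (Bond V))) :=
  {γ' | IsPrimitivePseudoOrbit γ' ∧ topLength γ' = topLength γ ∧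
    metricLength L γ' = metricLength L γ}

theorem partners_finite {V : ℕ} (L : Bond V → ℝ) (γ : Finset (Cycle (Bond V))) :
    (partners L γ).Finite := by
  have h1 : {c : Cycle (Bond V) | c.length ≤ topLength γ}.Finite := by
    refine ((List.finite_length_le (Bond V) (topLength γ)).image
      (fun l : List (Bond V) => (l : Cycle (Bond V)))).subset ?_
    intro c
    induction c using Quotient.inductionOn with
    | _ l => exact fun h => ⟨l, h, rfl⟩
  have h2 : {γ' : Finset (Cycle (Bond V)) | γ' ⊆ h1.toFinset}.Finite :=
    (h1.toFinset.powerset.finite_toSet).subset fun γ' h => by simpa using h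
  refine h2.subset fun γ' h c hc => ?_
  rw [Set.Finite.mem_toFinset]
  exact (Finset.single_le_sum (f := fun c : Cycle (Bond V) => c.length)
    (fun _ _ => Nat.zero_le _) hc).trans h.2.1.le

/-- The contribution to the variance of `γ` paired with all its partners. -/
noncomputable def contribution {V : ℕ} (L : Bond V → ℝ) (ν : BondNumbering V)
    (γ : Finset (Cycle (Bond V))) : ℂ :=
  ∑ γ' ∈ (partners_finite L γ).toFinset,
    (-1 : ℂ) ^ (γ.card + γ'.card) * amplitude ν γ * (starRingEnd ℂ) (amplitude ν γ')

/-- The sequences of `m` consecutive letters of a cyclic sequence, one for every starting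
position; the cyclic sequence is read periodically, so `m` may exceed its length. -/
def windows {α : Type*} (m : ℕ) (c : Cycle α) : Multiset (List α) :=
  c.lists.map fun l => (List.replicate m l).flatten.take m

/-- The sequences of `m` consecutive vertices in a pseudo orbit, with multiplicity. -/
def vertexWindows {V : ℕ} (m : ℕ) (γ : Finset (Cycle (Bond V))) : Multiset (List (Fin V)) :=
  ∑ c ∈ γ, windows m (c.map origin)

/-- The number of times a vertex sequence appears in a pseudo orbit. -/
def occurrences {V : ℕ} (γ : Finset (Cycle (Bond V))) (e : List (Fin V)) : ℕ :=
  (vertexWindows e.length γ).count e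

/-- The encounters (self-intersections) of `γ`: the vertex sequences that appear at least twice
in `γ`, such that the vertices preceding the appearances are not all equal and the vertices
following them are not all equal (so no longer sequence containing it appears as often).
An encounter `e` is an `ℓ`-encounter for `ℓ = occurrences γ e`. -/
def encounters {V : ℕ} (γ : Finset (Cycle (Bond V))) : Set (List (Fin V)) :=
  {e | e ≠ [] ∧ 2 ≤ occurrences γ e ∧
    (∃ s s', s ≠ s' ∧ s :: e ∈ vertexWindows (e.length + 1) γ ∧
      s' :: e ∈ vertexWindows (e.length + 1) γ) ∧
    ∃ f f', f ≠ f' ∧ e ++ [f] ∈ vertexWindows (e.length + 1) γ ∧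
      e ++ [f'] ∈ vertexWindows (e.length + 1) γ}

/-- The length of an encounter `(v₀, …, vₘ)`: its number `m` of bonds. -/
def encounterLength {V : ℕ} (e : List (Fin V)) : ℕ := e.length - 1

end BinaryGraph

/-! Incommensurability turns equality of metric lengths into equality of bond content, the multiset
of bonds used. The sum over partners $\bar\gamma'$ of $(-1)^{m_{\bar\gamma'}}A_{\bar\gamma'}$ is
thus the part of given content in the product of $1-A_c$ over primitive cyclic words $c$. This
product expands $\det(1-\boldsymbol\Sigma)$ over pseudo orbits: the logarithmic derivative of
$\det(1-X\boldsymbol\Sigma)$ generates the traces of powers of $\boldsymbol\Sigma$, and these are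
sums over powers of primitive cyclic words (`sum_primCycles_eq_sum_minors`). Giving each column of
$\boldsymbol\Sigma$ its own variable separates the contents (`sum_primCycles_content_eq`). The
determinant is affine in each variable, so a content with a repeated bond contributes $0$, and a set
$s$ of bonds contributes $(-1)^{|s|}$ times the principal minor of $\boldsymbol\Sigma$ on $s$.

If no bond is repeated, $\bar\gamma$ is a permutation $\sigma$ of its bonds, of sign
$(-1)^{n+m_{\bar\gamma}}$. Permuting the rows of the minor by $\sigma$ makes it block diagonal, with
one block per vertex. A block of size one is an entry of the vertex matrix; one of size two has a
determinant equal to twice its diagonal term. The minor is therefore $\pm 2^N A_{\bar\gamma}$, with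
$N$ the number of vertices visited twice, and $|A_{\bar\gamma}|^2=2^{-n}$ gives $2^{N-n}$
(`contribution_eq_pow`).

Encounters enter only through repeated bonds. Positive length repeats a bond, and so does a third
visit to a vertex with two outgoing bonds (`not_nodup_of_occurrences`). Conversely, with a repeated
bond, a longest repeated vertex sequence is an encounter of positive length
(`exists_encounter_of_not_nodup`). -/

namespace CyclicWord

/-! ### Powers, rotations, periods and windows of words. -/

variable {α : Type*}

/-- The concatenation of `j` copies of a word. -/
def listPow (u : List α) (j : ℕ) : List α := (List.replicate j u).flatten

/-- The rotation of words by one letter. -/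
def rot (l : List α) : List α := l.rotate 1

@[simp] theorem listPow_zero (u : List α) : listPow u 0 = [] := rfl

theorem listPow_succ (u : List α) (j : ℕ) : listPow u (j + 1) = u ++ listPow u j := rfl

theorem listPow_succ' (u : List α) (j : ℕ) : listPow u (j + 1) = listPow u j ++ u := by
  induction j with
  | zero => simp [listPow_succ]
  | succ j ih => rw [listPow_succ, ih, ← List.append_assoc, ← listPow_succ, ih]

@[simp] theorem length_listPow (u : List α) (j : ℕ) :
    (listPow u j).length = j * u.length := by
  simp [listPow]

theorem rot_iterate (l : List α) (i : ℕ) : rot^[i] l = l.rotate i := by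
  induction i with
  | zero => simp
  | succ i ih => rw [Function.iterate_succ_apply', ih, rot, List.rotate_rotate]

@[simp] theorem length_rot (l : List α) : (rot l).length = l.length := by simp [rot]

theorem rot_cons (a : α) (t : List α) : rot (a :: t) = t ++ [a] := by simp [rot]

/-- Splitting off the first letter leaves a power of the rotated word; this drives both the rotation
of powers and the recursion for windows. -/
theorem listPow_succ_cons (a : α) (t : List α) (j : ℕ) :
    listPow (a :: t) (j + 1) = a :: (listPow (rot (a :: t)) j ++ t) := by
  induction j with
  | zero => simp [listPow_succ]
  | succ j ih =>
    rw [listPow_succ, ih, listPow_succ (rot (a :: t)), rot_cons]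
    simp

theorem rot_listPow (u : List α) (j : ℕ) : rot (listPow u j) = listPow (rot u) j := by
  rcases u with _ | ⟨a, t⟩
  · simp [listPow, rot]
  rcases j with _ | j
  · simp [rot]
  rw [listPow_succ_cons, rot_cons, listPow_succ', rot_cons]
  simp

theorem rot_iterate_listPow (u : List α) (j i : ℕ) :
    rot^[i] (listPow u j) = listPow (rot^[i] u) j := by
  induction i with
  | zero => rfl
  | succ i ih => rw [Function.iterate_succ_apply', ih, rot_listPow, Function.iterate_succ_apply']

theorem listPow_inj {u v : List α} {j : ℕ} (hj : j ≠ 0) (hl : u.length = v.length)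
    (h : listPow u j = listPow v j) : u = v := by
  obtain ⟨j, rfl⟩ := Nat.exists_eq_succ_of_ne_zero hj
  rw [Nat.succ_eq_add_one, listPow_succ, listPow_succ] at h
  exact (List.append_inj h hl).1

/-- The smallest positive rotation that fixes a word. -/
noncomputable def period (l : List α) : ℕ := Function.minimalPeriod rot l

theorem rot_iterate_length (l : List α) : Function.IsPeriodicPt rot l.length l := by
  rw [Function.IsPeriodicPt, Function.IsFixedPt, rot_iterate, List.rotate_length]

theorem period_dvd_length (l : List α) : period l ∣ l.length :=
  (rot_iterate_length l).minimalPeriod_dvd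

theorem period_pos {l : List α} (hl : l ≠ []) : 0 < period l :=
  (rot_iterate_length l).minimalPeriod_pos (List.length_pos_of_ne_nil hl)

/-- Rotation commutes with powers, and taking powers is injective on words of equal length, so the
same rotations fix both words. -/
theorem period_listPow (u : List α) {j : ℕ} (hj : j ≠ 0) : period (listPow u j) = period u := by
  refine Function.minimalPeriod_eq_minimalPeriod_iff.2 fun n => ?_
  simp only [Function.IsPeriodicPt, Function.IsFixedPt, rot_iterate_listPow]
  refine ⟨fun h => listPow_inj hj ?_ h, fun h => by rw [h]⟩
  rw [rot_iterate, List.length_rotate]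

theorem period_rotate (l : List α) (i : ℕ) : period (l.rotate i) = period l := by
  refine Function.minimalPeriod_eq_minimalPeriod_iff.2 fun n => ?_
  simp only [Function.IsPeriodicPt, Function.IsFixedPt, rot_iterate, List.rotate_rotate]
  rw [add_comm, ← List.rotate_rotate]
  exact (List.rotate_injective i).eq_iff

/-- The word of the first `m` letters of the periodic continuation of `l`. -/
def window (m : ℕ) (l : List α) : List α := (listPow l m).take m

@[simp] theorem window_zero (l : List α) : window 0 l = [] := by simp [window]

/-- Since each copy of a nonempty word has at least one letter, `m` copies already determine `m`
letters. -/
theorem take_listPow_of_le {l : List α} (hl : l ≠ []) {m k : ℕ} (h : m ≤ k) :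
    (listPow l k).take m = window m l := by
  obtain ⟨d, rfl⟩ := Nat.exists_eq_add_of_le h
  induction d with
  | zero => rfl
  | succ d ih =>
    rw [← add_assoc, listPow_succ', List.take_append_of_le_length, ih (by omega)]
    rw [length_listPow]
    have := List.length_pos_of_ne_nil hl
    nlinarith

theorem window_succ_cons (a : α) (t : List α) (m : ℕ) :
    window (m + 1) (a :: t) = a :: window m (rot (a :: t)) := by
  rw [window, listPow_succ_cons, List.take_succ_cons, List.take_append_of_le_length, window]
  simp only [length_listPow, length_rot, List.length_cons]
  nlinarith

theorem window_succ {l : List α} (hl : l ≠ []) (m : ℕ) :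
    window (m + 1) l = l.head hl :: window m (rot l) := by
  obtain ⟨a, t, rfl⟩ := List.exists_cons_of_ne_nil hl
  exact window_succ_cons a t m

theorem length_window {l : List α} (hl : l ≠ []) (m : ℕ) : (window m l).length = m := by
  have := List.length_pos_of_ne_nil hl
  simp only [window, List.length_take, length_listPow]
  exact min_eq_left (by nlinarith)

theorem rot_ne_nil {l : List α} (hl : l ≠ []) : rot l ≠ [] := by
  simpa [rot] using hl

theorem rot_iterate_ne_nil {l : List α} (hl : l ≠ []) (i : ℕ) : rot^[i] l ≠ [] := by
  simpa [rot_iterate] using hl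

theorem window_add {l : List α} (hl : l ≠ []) (m k : ℕ) :
    window (m + k) l = window m l ++ window k (rot^[m] l) := by
  induction m generalizing l with
  | zero => simp
  | succ m ih =>
    rw [show m + 1 + k = (m + k) + 1 by omega, window_succ hl, window_succ hl, ih (rot_ne_nil hl)]
    simp

theorem window_length (l : List α) : window l.length l = l := by
  rcases eq_or_ne l [] with rfl | hl
  · simp
  rw [← take_listPow_of_le hl le_rfl]
  obtain ⟨j, hj⟩ := Nat.exists_eq_succ_of_ne_zero (List.length_pos_of_ne_nil hl).ne'
  rw [hj, Nat.succ_eq_add_one, listPow_succ, ← Nat.succ_eq_add_one, ← hj, List.take_left]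

theorem take_window {l : List α} (hl : l ≠ []) {m k : ℕ} (h : m ≤ k) :
    (window k l).take m = window m l := by
  rw [window, List.take_take, min_eq_left h, take_listPow_of_le hl h]

theorem window_mul_of_isPeriodicPt {l : List α} (hl : l ≠ []) {d : ℕ}
    (hd : Function.IsPeriodicPt rot d l) (j : ℕ) :
    window (j * d) l = listPow (window d l) j := by
  induction j with
  | zero => simp
  | succ j ih =>
    rw [Nat.succ_mul, window_add hl, ih, listPow_succ', (hd.const_mul j).eq]

theorem window_eq_listPow {l : List α} (hl : l ≠ []) (j : ℕ) :
    window (j * l.length) l = listPow l j := by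
  rw [window_mul_of_isPeriodicPt hl (rot_iterate_length l), window_length]

theorem isPeriodicPt_period (l : List α) : Function.IsPeriodicPt rot (period l) l :=
  Function.isPeriodicPt_minimalPeriod rot l

theorem window_period_listPow {l : List α} (hl : l ≠ []) :
    listPow (window (period l) l) (l.length / period l) = l := by
  rw [← window_mul_of_isPeriodicPt hl (isPeriodicPt_period l),
    Nat.div_mul_cancel (period_dvd_length l), window_length]

theorem length_div_period_ne_zero {l : List α} (hl : l ≠ []) : l.length / period l ≠ 0 :=
  (Nat.div_pos (Nat.le_of_dvd (List.length_pos_of_ne_nil hl) (period_dvd_length l))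
    (period_pos hl)).ne'

theorem period_window_period {l : List α} (hl : l ≠ []) :
    period (window (period l) l) = period l := by
  conv_rhs => rw [← window_period_listPow hl]
  rw [period_listPow _ (length_div_period_ne_zero hl)]

theorem isPrimitive_ne_nil {c : Cycle α} (hc : BinaryGraph.IsPrimitive c) : c ≠ Cycle.nil := by
  rintro rfl
  exact hc [] 2 le_rfl (by simp)

/-- A word is a power of its first `period l` letters. Conversely a proper power has the period of
its base, which is shorter than the word. -/
theorem isPrimitive_coe_iff {l : List α} :
    BinaryGraph.IsPrimitive (l : Cycle α) ↔ l ≠ [] ∧ period l = l.length := by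
  constructor
  · intro h
    have hl : l ≠ [] := by
      rintro rfl
      exact isPrimitive_ne_nil h rfl
    refine ⟨hl, ?_⟩
    by_contra hne
    obtain ⟨k, hk⟩ := period_dvd_length l
    refine h (window (period l) l) (l.length / period l) ?_ ?_
    · have h0 := length_div_period_ne_zero hl
      have h1 : l.length / period l ≠ 1 := fun h1 => by
        have := Nat.div_mul_cancel (period_dvd_length l)
        rw [h1, one_mul] at this
        exact hne this
      exact (Nat.two_le_iff _).2 ⟨h0, h1⟩
    · exact congrArg _ (window_period_listPow hl).symm
  · rintro ⟨hl, hp⟩ w k hk h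
    obtain ⟨i, hi⟩ := Cycle.coe_eq_coe.1 h
    change l.rotate i = listPow w k at hi
    have h1 : period l = period w := by
      rw [← period_rotate l i, hi, period_listPow w (by omega)]
    have h2 : l.length = k * w.length := by
      rw [← length_listPow, ← hi, List.length_rotate]
    have h3 : w ≠ [] := by
      rintro rfl
      simp at h2
      exact hl h2
    have h4 := List.length_pos_of_ne_nil h3
    have h5 := Nat.le_of_dvd h4 (period_dvd_length w)
    nlinarith

theorem nodup_lists {c : Cycle α} (hc : BinaryGraph.IsPrimitive c) : c.lists.Nodup := by
  induction c using Quotient.inductionOn with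
  | _ l =>
    obtain ⟨hl, hp⟩ := isPrimitive_coe_iff.1 hc
    change (Cycle.lists (l : Cycle α)).Nodup
    rw [Cycle.lists_coe, Multiset.coe_nodup, List.nodup_iff_injective_get]
    rintro ⟨i, hi⟩ ⟨j, hj⟩ h
    rw [List.length_cyclicPermutations_of_ne_nil _ hl] at hi hj
    simp only [List.get_eq_getElem, List.getElem_cyclicPermutations, ← rot_iterate] at h
    rw [← hp] at hi hj
    simpa using Function.iterate_injOn_Iio_minimalPeriod hi hj h

theorem card_lists {c : Cycle α} (hc : c ≠ Cycle.nil) : Multiset.card c.lists = c.length := by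
  induction c using Quotient.inductionOn with
  | _ l =>
    have hl : l ≠ [] := by rintro rfl; exact hc rfl
    change Multiset.card (Cycle.lists (l : Cycle α)) = Cycle.length (l : Cycle α)
    simp [Cycle.lists_coe, List.length_cyclicPermutations_of_ne_nil _ hl]

/-- Two primitive words whose periodic continuations have a long common beginning are equal. -/
theorem eq_of_window_eq {u v : List α} (hu : BinaryGraph.IsPrimitive (u : Cycle α))
    (hv : BinaryGraph.IsPrimitive (v : Cycle α)) {m : ℕ} (hm : u.length * v.length ≤ m)
    (h : window m u = window m v) : u = v := by
  obtain ⟨hu0, hu1⟩ := isPrimitive_coe_iff.1 hu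
  obtain ⟨hv0, hv1⟩ := isPrimitive_coe_iff.1 hv
  have hul := (List.length_pos_of_ne_nil hu0).ne'
  have hvl := (List.length_pos_of_ne_nil hv0).ne'
  -- Both powers are the window of length `u.length * v.length`; equal powers have bases of equal
  -- period, which is their length by primitivity.
  have h1 : listPow u v.length = listPow v u.length := by
    rw [← window_eq_listPow hu0, ← window_eq_listPow hv0, mul_comm v.length,
      ← take_window hu0 hm, ← take_window hv0 hm, h]
  have h2 : u.length = v.length := by
    rw [← hu1, ← hv1, ← period_listPow u hvl, h1, period_listPow v hul]
  rw [h2] at h1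
  exact listPow_inj hvl h2 h1

end CyclicWord

/-! ### Traces of matrix powers as sums over primitive cyclic words. -/

namespace CyclicWord

open BinaryGraph

section Words

variable {β : Type*}

/-- The primitive cyclic word of which a given word is a power. -/
noncomputable def root (l : List β) : Cycle β := (window (period l) l : List β)

theorem length_root {l : List β} (hl : l ≠ []) : (root l).length = period l := by
  rw [root, Cycle.length_coe, length_window hl]

theorem isPrimitive_root {l : List β} (hl : l ≠ []) : IsPrimitive (root l) := by
  rw [root, isPrimitive_coe_iff, length_window hl, period_window_period hl]
  refine ⟨?_, rfl⟩
  rw [← List.length_pos_iff_ne_nil, length_window hl]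
  exact period_pos hl

theorem root_listPow {u : List β} (hu : IsPrimitive (u : Cycle β)) {j : ℕ} (hj : j ≠ 0) :
    root (listPow u j) = (u : Cycle β) := by
  obtain ⟨hu0, hu1⟩ := isPrimitive_coe_iff.1 hu
  have h0 : listPow u j ≠ [] := by
    rw [← List.length_pos_iff_ne_nil, length_listPow]
    exact Nat.mul_pos (Nat.pos_of_ne_zero hj) (List.length_pos_of_ne_nil hu0)
  have h1 := window_period_listPow h0
  rw [period_listPow u hj, hu1, length_listPow,
    Nat.mul_div_cancel _ (List.length_pos_of_ne_nil hu0)] at h1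
  rw [root, period_listPow u hj, hu1, listPow_inj hj (length_window h0 _) h1]

variable [Finite β]

/-- The words of length `k`. -/
noncomputable def words (β : Type*) [Finite β] (k : ℕ) : Finset (List β) :=
  (List.finite_length_eq β k).toFinset

@[simp] theorem mem_words {k : ℕ} {l : List β} : l ∈ words β k ↔ l.length = k := by
  simp [words]

theorem words_zero : words β 0 = {[]} := by
  ext l
  simp

theorem sum_words_succ {β M : Type*} [Fintype β] [AddCommMonoid M] (k : ℕ) (f : List β → M) :
    ∑ l ∈ words β (k + 1), f l = ∑ a, ∑ t ∈ words β k, f (a :: t) := by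
  rw [← Finset.sum_product']
  refine (Finset.sum_bij (fun (x : β × List β) _ => x.1 :: x.2) ?_ ?_ ?_ ?_).symm
  · rintro ⟨a, t⟩ h
    simpa using h
  · rintro ⟨a, t⟩ _ ⟨b, s⟩ _ h
    simpa using h
  · intro l hl
    rw [mem_words] at hl
    obtain ⟨a, t, rfl⟩ := List.exists_cons_of_length_eq_add_one hl
    exact ⟨(a, t), by simpa using hl, rfl⟩
  · simp

theorem finite_primitive_length_le (β : Type*) [Finite β] (N : ℕ) :
    {c : Cycle β | IsPrimitive c ∧ c.length ≤ N}.Finite := by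
  refine ((List.finite_length_le β N).image (fun l : List β => (l : Cycle β))).subset ?_
  rintro c ⟨-, h⟩
  induction c using Quotient.inductionOn with
  | _ l => exact ⟨l, h, rfl⟩

/-- The primitive cyclic words of length at most `N`. -/
noncomputable def primCycles (β : Type*) [Finite β] (N : ℕ) : Finset (Cycle β) :=
  (finite_primitive_length_le β N).toFinset

@[simp] theorem mem_primCycles {N : ℕ} {c : Cycle β} :
    c ∈ primCycles β N ↔ IsPrimitive c ∧ c.length ≤ N := by
  simp [primCycles]

-- A primitive cyclic word contributes one power for each of its rotations, hence the factor
-- `c.length` in the trace formula.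
open Classical in
theorem filter_root_eq {k N : ℕ} (hk : k ≠ 0) {c : Cycle β} (hc : c ∈ primCycles β N) :
    {l ∈ words β k | root l = c} =
      if c.length ∣ k then c.lists.toFinset.image (listPow · (k / c.length)) else ∅ := by
  rw [mem_primCycles] at hc
  ext l
  simp only [Finset.mem_filter, mem_words]
  constructor
  · rintro ⟨hl, rfl⟩
    have hl0 : l ≠ [] := by
      rintro rfl
      exact hk hl.symm
    rw [length_root hl0, if_pos (hl ▸ period_dvd_length l), Finset.mem_image]
    refine ⟨window (period l) l, ?_, ?_⟩
    · rw [Multiset.mem_toFinset, Cycle.mem_lists_iff_coe_eq, root]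
    · rw [← hl, window_period_listPow hl0]
  · intro h
    split_ifs at h with hd
    · obtain ⟨u, hu, rfl⟩ := Finset.mem_image.1 h
      rw [Multiset.mem_toFinset, Cycle.mem_lists_iff_coe_eq] at hu
      subst hu
      rw [Cycle.length_coe] at hd ⊢
      have hu0 := List.length_pos_of_ne_nil (isPrimitive_coe_iff.1 hc.1).1
      refine ⟨by rw [length_listPow, Nat.div_mul_cancel hd], root_listPow hc.1 ?_⟩
      exact (Nat.div_pos (Nat.le_of_dvd (Nat.pos_of_ne_zero hk) hd) hu0).ne'
    · simp at h

/-- A sum over all words, organized by the primitive cyclic words of which they are powers. -/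
theorem sum_words_eq_sum_primCycles {R : Type*} [CommSemiring R] {k N : ℕ} (hk : k ≠ 0)
    (hkN : k ≤ N) (f : List β → R) (F : Cycle β → R)
    (hf : ∀ u j, f (listPow u j) = F (u : Cycle β) ^ j) :
    ∑ l ∈ words β k, f l = ∑ c ∈ primCycles β N,
      if c.length ∣ k then (c.length : R) * F c ^ (k / c.length) else 0 := by
  classical
  rw [← Finset.sum_fiberwise_of_maps_to (t := primCycles β N) (g := root)]
  · refine Finset.sum_congr rfl fun c hc => ?_
    rw [filter_root_eq hk hc]
    rw [mem_primCycles] at hc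
    split_ifs with hd
    · have hc0 := isPrimitive_ne_nil hc.1
      have hpos : 0 < c.length := by
        rw [← card_lists hc0, Multiset.card_pos]
        intro h
        induction c using Quotient.inductionOn with
        | _ l =>
          have : l ∈ (Cycle.lists (l : Cycle β)) := Cycle.mem_lists_iff_coe_eq.2 rfl
          exact absurd (h ▸ this) (Multiset.notMem_zero _)
      have hq : k / c.length ≠ 0 :=
        (Nat.div_pos (Nat.le_of_dvd (Nat.pos_of_ne_zero hk) hd) hpos).ne'
      rw [Finset.sum_image]
      · rw [Finset.sum_congr rfl (g := fun _ => F c ^ (k / c.length))]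
        · rw [Finset.sum_const, Multiset.toFinset_card_of_nodup (nodup_lists hc.1),
            card_lists hc0, nsmul_eq_mul]
        · intro u hu
          rw [Multiset.mem_toFinset, Cycle.mem_lists_iff_coe_eq] at hu
          rw [hf, hu]
      · intro u hu v hv h
        rw [Finset.mem_coe, Multiset.mem_toFinset, Cycle.mem_lists_iff_coe_eq] at hu hv
        refine listPow_inj hq ?_ h
        rw [← Cycle.length_coe, hu, ← hv, Cycle.length_coe]
    · simp
  · intro l hl
    rw [mem_words] at hl
    have hl0 : l ≠ [] := by
      rintro rfl
      exact hk hl.symm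
    rw [mem_primCycles, length_root hl0]
    refine ⟨isPrimitive_root hl0, ?_⟩
    have := Nat.le_of_dvd (List.length_pos_of_ne_nil hl0) (period_dvd_length l)
    omega

end Words

section Amplitudes

variable {β : Type*}

theorem zipWith_listPow {γ δ : Type*} (f : β → γ → δ) {u : List β} {v : List γ}
    (h : u.length = v.length) (j : ℕ) :
    List.zipWith f (listPow u j) (listPow v j) = listPow (List.zipWith f u v) j := by
  induction j with
  | zero => simp
  | succ j ih => rw [listPow_succ, listPow_succ, List.zipWith_append h, ih, listPow_succ]

theorem prod_listPow {R : Type*} [Monoid R] (u : List R) (j : ℕ) :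
    (listPow u j).prod = u.prod ^ j := by
  induction j with
  | zero => simp
  | succ j ih => rw [listPow_succ, List.prod_append, ih, pow_succ']

/-- A power zipped with its rotation is the power of the zipped base. -/
theorem listAmplitude_listPow (S : Matrix β β ℂ) (u : List β) (j : ℕ) :
    listAmplitude S (listPow u j) = listAmplitude S u ^ j := by
  unfold listAmplitude
  rw [show (listPow u j).rotate 1 = listPow (u.rotate 1) j from rot_listPow u j,
    zipWith_listPow _ (by simp), prod_listPow]

/-- The product of the matrix entries along the path from `a` through `t` to `b`. -/
def pathAmplitude (S : Matrix β β ℂ) : β → List β → β → ℂ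
  | a, [], b => S b a
  | a, c :: t, b => S c a * pathAmplitude S c t b

theorem prod_zipWith_cons_append (S : Matrix β β ℂ) (a : β) (t : List β) (b : β) :
    (List.zipWith (fun b b' => S b' b) (a :: t) (t ++ [b])).prod = pathAmplitude S a t b := by
  induction t generalizing a with
  | nil => simp [pathAmplitude]
  | cons c t ih => rw [List.cons_append, List.zipWith_cons_cons, List.prod_cons, ih, pathAmplitude]

theorem listAmplitude_cons (S : Matrix β β ℂ) (a : β) (t : List β) :
    listAmplitude S (a :: t) = pathAmplitude S a t a := by
  rw [← prod_zipWith_cons_append, listAmplitude, ← rot_cons, rot]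

variable [Fintype β] [DecidableEq β]

theorem sum_pathAmplitude (S : Matrix β β ℂ) (k : ℕ) (a b : β) :
    ∑ t ∈ words β k, pathAmplitude S a t b = (S ^ (k + 1)) b a := by
  induction k generalizing a with
  | zero => simp [words_zero, pathAmplitude]
  | succ k ih =>
    rw [sum_words_succ, pow_succ, Matrix.mul_apply]
    refine Finset.sum_congr rfl fun c _ => ?_
    rw [← ih, Finset.sum_mul]
    exact Finset.sum_congr rfl fun t _ => mul_comm _ _

theorem sum_listAmplitude (S : Matrix β β ℂ) {k : ℕ} (hk : k ≠ 0) :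
    ∑ l ∈ words β k, listAmplitude S l = (S ^ k).trace := by
  obtain ⟨k, rfl⟩ := Nat.exists_eq_succ_of_ne_zero hk
  rw [Nat.succ_eq_add_one, sum_words_succ, Matrix.trace]
  refine Finset.sum_congr rfl fun a _ => ?_
  simp_rw [listAmplitude_cons]
  rw [sum_pathAmplitude, Matrix.diag]

/-- The trace of a power of a matrix as a sum over the primitive cyclic words. -/
theorem trace_pow_eq_sum_primCycles (S : Matrix β β ℂ) {k N : ℕ} (hk : k ≠ 0) (hkN : k ≤ N) :
    (S ^ k).trace = ∑ c ∈ primCycles β N,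
      if c.length ∣ k then (c.length : ℂ) * orbitAmplitude S c ^ (k / c.length) else 0 := by
  rw [← sum_listAmplitude S hk]
  exact sum_words_eq_sum_primCycles hk hkN _ _ fun u j => listAmplitude_listPow S u j

end Amplitudes

end CyclicWord

/-! ### The Euler product for $\det(1-XS)$, by logarithmic derivatives. -/

namespace CyclicWord

open BinaryGraph

theorem derivation_prod {K A ι : Type*} [CommRing K] [CommRing A] [Algebra K A] [DecidableEq ι]
    (D : Derivation K A A) (s : Finset ι) (f : ι → A) :
    D (∏ i ∈ s, f i) = ∑ i ∈ s, (∏ j ∈ s.erase i, f j) * D (f i) := by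
  induction s using Finset.induction_on with
  | empty => simp
  | insert a s ha ih =>
    rw [Finset.prod_insert ha, Derivation.leibniz, ih, Finset.sum_insert ha,
      Finset.erase_insert ha, smul_eq_mul, smul_eq_mul, add_comm, Finset.mul_sum]
    congr 1
    refine Finset.sum_congr rfl fun i hi => ?_
    have hia : a ≠ i := fun h => ha (h ▸ hi)
    rw [Finset.erase_insert_of_ne hia,
      Finset.prod_insert fun h => ha (Finset.mem_of_mem_erase h), mul_assoc]

/-- Jacobi's formula for the derivative of a determinant. -/
theorem derivation_det {K A n : Type*} [CommRing K] [CommRing A] [Algebra K A] [Fintype n]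
    [DecidableEq n] (D : Derivation K A A) (M : Matrix n n A) :
    D M.det = (M.adjugate * M.map D).trace := by
  -- The product rule differentiates one column at a time; summing over `σ` gives determinants with
  -- one column replaced, which are entries of Cramer's vector.
  have h1 : ∀ σ : Equiv.Perm n, D (∏ i, M (σ i) i) =
      ∑ i, ∏ j, (M.updateCol i (fun a => D (M a i))) (σ j) j := by
    intro σ
    rw [derivation_prod]
    refine Finset.sum_congr rfl fun i _ => ?_
    rw [← Finset.prod_erase_mul _ _ (Finset.mem_univ i), Matrix.updateCol_self]
    congr 1
    exact Finset.prod_congr rfl fun j hj => by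
      rw [Matrix.updateCol_ne (Finset.ne_of_mem_erase hj)]
  rw [Matrix.det_apply, map_sum]
  simp_rw [Units.smul_def, map_zsmul, h1, Finset.smul_sum]
  rw [Finset.sum_comm, Matrix.trace]
  refine Finset.sum_congr rfl fun i _ => ?_
  simp_rw [← Units.smul_def]
  rw [← Matrix.det_apply, ← Matrix.cramer_apply, Matrix.cramer_eq_adjugate_mulVec]
  rfl

open PowerSeries

/-- The logarithmic derivative of a power series determines its coefficients. -/
theorem coeff_eq_of_logDeriv_eq {F G T U : ℂ⟦X⟧} {N : ℕ}
    (h0 : coeff 0 F = coeff 0 G)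
    (hF : X * d⁄dX ℂ F = -(F * T)) (hG : X * d⁄dX ℂ G = -(G * U))
    (hT0 : coeff 0 T = 0) (hU0 : coeff 0 U = 0)
    (hTU : ∀ k ≤ N, k ≠ 0 → coeff k T = coeff k U) {k : ℕ} (hk : k ≤ N) :
    coeff k F = coeff k G := by
  induction k using Nat.strong_induction_on with
  | _ k ih =>
    rcases k with _ | k
    · exact h0
    have h1 := congrArg (coeff (k + 1)) hF
    have h2 := congrArg (coeff (k + 1)) hG
    rw [coeff_succ_X_mul, coeff_derivative, map_neg, coeff_mul] at h1 h2
    have h3 : ∑ p ∈ Finset.HasAntidiagonal.antidiagonal (k + 1), coeff p.1 F * coeff p.2 T =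
        ∑ p ∈ Finset.HasAntidiagonal.antidiagonal (k + 1), coeff p.1 G * coeff p.2 U := by
      refine Finset.sum_congr rfl fun p hp => ?_
      rw [Finset.HasAntidiagonal.mem_antidiagonal] at hp
      -- The term with `p.2 = 0` contains the still unknown coefficient, but `T` and `U` have no
      -- constant term.
      rcases Nat.eq_zero_or_pos p.2 with h | h
      · rw [h, hT0, hU0, mul_zero, mul_zero]
      · rw [ih p.1 (by omega) (by omega), hTU p.2 (by omega) h.ne']
    rw [h3, ← h2] at h1
    exact mul_right_cancel₀ (by exact_mod_cast k.succ_ne_zero) h1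

/-- The power series with coefficient `d * w ^ (k / d)` at the positive multiples `k` of `d`. -/
noncomputable def orbitSeries (d : ℕ) (w : ℂ) : ℂ⟦X⟧ :=
  PowerSeries.mk fun k => if k ≠ 0 ∧ d ∣ k then (d : ℂ) * w ^ (k / d) else 0

/-- `orbitSeries d w` is the geometric series $d\,wX^d/(1-wX^d)$, so the product with $1-wX^d$
telescopes. -/
theorem X_mul_derivative_one_sub_monomial {d : ℕ} (hd : d ≠ 0) (w : ℂ) :
    X * d⁄dX ℂ (1 - monomial d w) = -((1 - monomial d w) * orbitSeries d w) := by
  have h1 : X * d⁄dX ℂ (1 - monomial d w) = -monomial d (d * w) := by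
    ext k
    rcases k with _ | k
    · rw [coeff_zero_X_mul, map_neg, coeff_monomial, if_neg hd.symm, neg_zero]
    · rw [coeff_succ_X_mul, coeff_derivative, map_sub, map_neg, coeff_monomial, coeff_monomial,
        coeff_one, if_neg k.succ_ne_zero]
      split_ifs with h
      · subst h
        push_cast
        ring
      · simp
  have hm : (monomial d w : ℂ⟦X⟧) = C w * X ^ d := by
    ext k
    simp [coeff_monomial, coeff_X_pow]
  rw [h1, neg_inj, sub_mul, one_mul]
  ext k
  rw [map_sub, hm, mul_assoc, coeff_C_mul, coeff_X_pow_mul', orbitSeries]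
  simp only [coeff_monomial, coeff_mk]
  rcases lt_trichotomy k d with h | rfl | h
  · rw [if_neg h.ne, if_neg (by omega : ¬ d ≤ k), if_neg, mul_zero, sub_zero]
    rintro ⟨h0, h1⟩
    exact absurd (Nat.le_of_dvd (Nat.pos_of_ne_zero h0) h1) (by omega)
  · simp [hd, Nat.div_self (Nat.pos_of_ne_zero hd)]
  · rw [if_neg h.ne', if_pos h.le]
    have h2 : d ∣ k - d ↔ d ∣ k := (Nat.dvd_sub_iff_left h.le dvd_rfl)
    by_cases hdk : d ∣ k
    · rw [if_pos ⟨by omega, hdk⟩, if_pos ⟨by omega, h2.2 hdk⟩,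
        Nat.div_eq_sub_div (Nat.pos_of_ne_zero hd) h.le]
      ring
    · rw [if_neg (fun h => hdk h.2), if_neg (fun h => hdk (h2.1 h.2)), mul_zero, sub_zero]

theorem X_mul_derivative_prod {ι : Type*} (s : Finset ι) (d : ι → ℕ) (w : ι → ℂ)
    (hd : ∀ i ∈ s, d i ≠ 0) :
    X * d⁄dX ℂ (∏ i ∈ s, (1 - monomial (d i) (w i))) =
      -((∏ i ∈ s, (1 - monomial (d i) (w i))) * ∑ i ∈ s, orbitSeries (d i) (w i)) := by
  classical
  induction s using Finset.induction_on with
  | empty => simp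
  | insert a s ha ih =>
    have h1 := ih fun i hi => hd i (Finset.mem_insert_of_mem hi)
    have h2 := X_mul_derivative_one_sub_monomial (hd a (Finset.mem_insert_self a s)) (w a)
    rw [Finset.prod_insert ha, Finset.sum_insert ha, Derivation.leibniz, smul_eq_mul, smul_eq_mul,
      mul_add, mul_left_comm, h1, mul_left_comm, h2]
    ring

theorem coeff_prod_one_sub_monomial {ι : Type*} [DecidableEq ι] (s : Finset ι) (d : ι → ℕ)
    (w : ι → ℂ) (k : ℕ) :
    coeff k (∏ i ∈ s, (1 - monomial (d i) (w i))) =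
      ∑ t ∈ s.powerset with ∑ i ∈ t, d i = k, (-1) ^ t.card * ∏ i ∈ t, w i := by
  have h : ∀ t : Finset ι, ∏ i ∈ t, -(monomial (d i) (w i) : ℂ⟦X⟧) =
      monomial (∑ i ∈ t, d i) ((-1) ^ t.card * ∏ i ∈ t, w i) := by
    intro t
    induction t using Finset.induction_on with
    | empty => simp
    | insert a t ha ih =>
      rw [Finset.prod_insert ha, ih, ← map_neg, monomial_mul_monomial, Finset.sum_insert ha,
        Finset.prod_insert ha, Finset.card_insert_of_notMem ha]
      congr 1
      ring
  simp_rw [sub_eq_add_neg]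
  rw [Finset.prod_one_add, map_sum, Finset.sum_filter]
  refine Finset.sum_congr rfl fun t _ => ?_
  rw [h, coeff_monomial]
  simp only [eq_comm]

section Determinant

variable {β : Type*} [Fintype β] [DecidableEq β]

/-- The generating function of the traces of the positive powers of a matrix. -/
noncomputable def traceSeries (S : Matrix β β ℂ) : ℂ⟦X⟧ :=
  PowerSeries.mk fun k => if k = 0 then 0 else (S ^ k).trace

/-- Jacobi's formula, with the adjugate read off from the Neumann series `G` $=\sum_k S^kX^k$, the
inverse of $1-XS$. -/
theorem X_mul_derivative_det (S : Matrix β β ℂ) :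
    X * d⁄dX ℂ (Matrix.det (1 - (X : ℂ⟦X⟧) • S.map (C (R := ℂ)))) =
      -(Matrix.det (1 - (X : ℂ⟦X⟧) • S.map (C (R := ℂ))) * traceSeries S) := by
  set N : Matrix β β ℂ⟦X⟧ := 1 - (X : ℂ⟦X⟧) • S.map (C (R := ℂ)) with hN
  let G : Matrix β β ℂ⟦X⟧ := Matrix.of fun i j => PowerSeries.mk fun k => (S ^ k) i j
  have hNG : N * G = 1 := by
    ext i j k
    rw [hN, sub_mul, one_mul, smul_mul_assoc, Matrix.sub_apply, Matrix.smul_apply, smul_eq_mul,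
      map_sub, Matrix.mul_apply]
    rcases k with _ | k
    · simp [G, Matrix.one_apply, apply_ite]
    · rw [coeff_succ_X_mul, map_sum]
      simp only [G, Matrix.map_apply, Matrix.of_apply, coeff_C_mul, coeff_mk]
      rw [← Matrix.mul_apply, ← pow_succ', sub_self, Matrix.one_apply]
      split_ifs <;> simp [coeff_one]
  have hadj : N.adjugate = N.det • G := by
    calc N.adjugate = N.adjugate * (N * G) := by rw [hNG, mul_one]
      _ = N.det • G := by rw [← mul_assoc, Matrix.adjugate_mul, smul_mul_assoc, one_mul]
  have hD : N.map (d⁄dX ℂ) = -S.map (C (R := ℂ)) := by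
    ext i j : 2
    simp only [hN, Matrix.map_apply, Matrix.sub_apply, Matrix.smul_apply, smul_eq_mul,
      Matrix.neg_apply, map_sub, Derivation.leibniz, Matrix.one_apply]
    split_ifs <;> simp [derivative_C, derivative_X]
  have hT : X * (G * S.map (C (R := ℂ))).trace = traceSeries S := by
    ext k
    rcases k with _ | k
    · simp [traceSeries]
    · rw [coeff_succ_X_mul, Matrix.trace, map_sum, traceSeries, coeff_mk, if_neg k.succ_ne_zero,
        pow_succ, Matrix.trace]
      refine Finset.sum_congr rfl fun i _ => ?_
      simp [G, Matrix.mul_apply, coeff_mul_C]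
  rw [derivation_det, hadj, hD, smul_mul_assoc, Matrix.trace_smul, mul_neg, Matrix.trace_neg, ← hT,
    smul_eq_mul]
  ring

theorem coeff_det_one_sub (S : Matrix β β ℂ) (k : ℕ) :
    coeff k (Matrix.det (1 - (X : ℂ⟦X⟧) • S.map (C (R := ℂ)))) =
      (-1) ^ k * ∑ s ∈ Finset.univ.powersetCard k,
        (S.submatrix (Subtype.val : s → β) (Subtype.val : s → β)).det := by
  have h1 : Matrix.det (1 - (X : ℂ⟦X⟧) • S.map (C (R := ℂ))) =
      ((Matrix.det (1 + (Polynomial.X : Polynomial ℂ) • (-S).map Polynomial.C) : Polynomial ℂ) :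
        ℂ⟦X⟧) := by
    rw [← Polynomial.coeToPowerSeries.ringHom_apply, RingHom.map_det]
    congr 1
    ext i j : 2
    simp only [RingHom.mapMatrix_apply, Matrix.map_apply, Matrix.add_apply, Matrix.sub_apply,
      Matrix.smul_apply, smul_eq_mul, map_add, map_mul, Polynomial.coeToPowerSeries.ringHom_apply,
      Polynomial.coe_X, Polynomial.coe_C, Matrix.neg_apply, map_neg, mul_neg, Matrix.one_apply]
    split_ifs <;> simp [sub_eq_add_neg]
  rw [h1, Polynomial.coeff_coe, Matrix.coeff_det_one_add_X_smul_eq_sum_minors, Finset.mul_sum]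
  refine Finset.sum_congr rfl fun s hs => ?_
  rw [Matrix.submatrix_neg, Pi.neg_apply, Pi.neg_apply, Matrix.det_neg, Fintype.card_coe,
    (Finset.mem_powersetCard.1 hs).2]

theorem length_ne_zero_of_isPrimitive {β : Type*} {c : Cycle β} (hc : IsPrimitive c) :
    c.length ≠ 0 := by
  rw [← Cycle.card_toMultiset, Ne, Multiset.card_eq_zero, Cycle.toMultiset_eq_nil]
  exact isPrimitive_ne_nil hc

/-- The expansion of `det (1 - S)` over sets of primitive cyclic words. -/
theorem sum_primCycles_eq_sum_minors (S : Matrix β β ℂ) (k : ℕ) :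
    ∑ t ∈ (primCycles β k).powerset with ∑ c ∈ t, c.length = k,
        (-1) ^ t.card * ∏ c ∈ t, orbitAmplitude S c =
      (-1) ^ k * ∑ s ∈ Finset.univ.powersetCard k,
        (S.submatrix (Subtype.val : s → β) (Subtype.val : s → β)).det := by
  rw [← coeff_det_one_sub, ← coeff_prod_one_sub_monomial]
  -- The trace formula matches the logarithmic derivatives only up to degree `k`, because words
  -- longer than `k` are left out of the product; this suffices for the coefficient of $X^k$.
  refine coeff_eq_of_logDeriv_eq (N := k) ?_ (X_mul_derivative_prod _ _ _ ?_)
    (X_mul_derivative_det S) ?_ ?_ ?_ le_rfl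
  · rw [coeff_prod_one_sub_monomial, coeff_det_one_sub, Finset.powersetCard_zero,
      Finset.sum_singleton, Finset.sum_eq_single ∅]
    · simp
    · intro t ht h
      obtain ⟨c, hc⟩ := Finset.nonempty_iff_ne_empty.2 h
      rw [Finset.mem_filter, Finset.mem_powerset, Finset.sum_eq_zero_iff] at ht
      exact absurd (ht.2 c hc) (length_ne_zero_of_isPrimitive (mem_primCycles.1 (ht.1 hc)).1)
    · simp
  · intro c hc
    exact length_ne_zero_of_isPrimitive (mem_primCycles.1 hc).1
  · simp [orbitSeries]
  · simp [traceSeries]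
  · intro j hj hj0
    rw [traceSeries, coeff_mk, if_neg hj0, trace_pow_eq_sum_primCycles S hj0 hj, map_sum]
    simp [orbitSeries, hj0]

end Determinant

end CyclicWord

/-! ### Separating the expansion by content. -/

namespace CyclicWord

open BinaryGraph

section Content

variable {β : Type*}

/-- The multiset of the letters of a set of cyclic words. -/
def content (t : Finset (Cycle β)) : Multiset β := ∑ c ∈ t, c.toMultiset

theorem card_content (t : Finset (Cycle β)) : Multiset.card (content t) = ∑ c ∈ t, c.length := by
  simp [content]

theorem prod_map_content (z : β → ℂ) (t : Finset (Cycle β)) :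
    ((content t).map z).prod = ∏ c ∈ t, (c.toMultiset.map z).prod := by
  classical
  induction t using Finset.induction_on with
  | empty => simp [content]
  | insert a t ha ih =>
    rw [Finset.prod_insert ha, ← ih, content, Finset.sum_insert ha, Multiset.map_add,
      Multiset.prod_add]
    rfl

theorem prod_zipWith_mul_left (z : β → ℂ) (g : β → β → ℂ) {l l' : List β}
    (h : l.length = l'.length) :
    (List.zipWith (fun b b' => z b * g b b') l l').prod =
      (l.map z).prod * (List.zipWith g l l').prod := by
  induction l generalizing l' with
  | nil => simp
  | cons a l ih =>
    obtain ⟨b, t, rfl⟩ := List.exists_cons_of_length_eq_add_one h.symm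
    rw [List.zipWith_cons_cons, List.prod_cons, ih (by simpa using h), List.map_cons,
      List.prod_cons, List.zipWith_cons_cons, List.prod_cons]
    ring

/-- Every letter of a cyclic word is a column index exactly once, so weighting column `b` by `z b`
makes the amplitude record the content. -/
theorem orbitAmplitude_mul_row (z : β → ℂ) (S : Matrix β β ℂ) (c : Cycle β) :
    orbitAmplitude (Matrix.of fun b' b => z b * S b' b) c =
      (c.toMultiset.map z).prod * orbitAmplitude S c := by
  induction c using Quotient.inductionOn with
  | _ l => exact prod_zipWith_mul_left z (fun b b' => S b' b) (by simp)

theorem eval_monomial_toFinsupp [DecidableEq β] (z : β → ℂ) (M : Multiset β) (a : ℂ) :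
    MvPolynomial.eval z (MvPolynomial.monomial (Multiset.toFinsupp M) a) =
      a * (M.map z).prod := by
  rw [MvPolynomial.eval_monomial, Finset.prod_multiset_map_count]
  rfl

variable [Fintype β] [DecidableEq β]

/-- The part of the expansion of `det (1 - S)` over sets of primitive cyclic words that has a
given content. -/
theorem sum_primCycles_content_eq (S : Matrix β β ℂ) (M : Multiset β) :
    ∑ t ∈ (primCycles β (Multiset.card M)).powerset with content t = M,
        (-1) ^ t.card * ∏ c ∈ t, orbitAmplitude S c =
      (-1) ^ (Multiset.card M) * ∑ s : Finset β with s.val = M,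
        (S.submatrix (Subtype.val : s → β) (Subtype.val : s → β)).det := by
  set k := Multiset.card M with hk
  let p : MvPolynomial β ℂ := ∑ t ∈ (primCycles β k).powerset with ∑ c ∈ t, c.length = k,
    MvPolynomial.monomial (Multiset.toFinsupp (content t))
      ((-1) ^ t.card * ∏ c ∈ t, orbitAmplitude S c)
  let q : MvPolynomial β ℂ := ∑ s ∈ Finset.univ.powersetCard k,
    MvPolynomial.monomial (Multiset.toFinsupp s.val)
      ((-1) ^ k * (S.submatrix (Subtype.val : s → β) (Subtype.val : s → β)).det)
  -- The unweighted identity, applied to every weighted matrix, makes the two polynomials agree at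
  -- every complex point. The monomials of `q` are squarefree.
  have hpq : p = q := by
    refine MvPolynomial.funext fun z => ?_
    have h := sum_primCycles_eq_sum_minors (Matrix.of fun b' b => z b * S b' b) k
    simp only [p, q, map_sum, eval_monomial_toFinsupp]
    convert h using 1
    · refine Finset.sum_congr rfl fun t _ => ?_
      simp_rw [orbitAmplitude_mul_row]
      rw [Finset.prod_mul_distrib, prod_map_content]
      ring
    · rw [Finset.mul_sum]
      refine Finset.sum_congr rfl fun s _ => ?_
      have h2 : (Matrix.of fun b' b => z b * S b' b).submatrix (Subtype.val : s → β)
          (Subtype.val : s → β) = Matrix.of fun i j : s => z j *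
            (S.submatrix (Subtype.val : s → β) (Subtype.val : s → β)) i j := rfl
      rw [h2, Matrix.det_mul_row (fun i : s => z i), Finset.prod_coe_sort s z, Finset.prod]
      ring
  have h := congrArg (MvPolynomial.coeff (Multiset.toFinsupp M)) hpq
  simp only [p, q, MvPolynomial.coeff_sum, MvPolynomial.coeff_monomial,
    EmbeddingLike.apply_eq_iff_eq] at h
  rw [← Finset.sum_filter, ← Finset.sum_filter, Finset.filter_filter] at h
  rw [Finset.mul_sum]
  convert h using 2
  · ext t
    simp only [Finset.mem_filter]
    refine and_congr_right fun _ => ⟨fun h => ⟨?_, h⟩, fun h => h.2⟩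
    rw [← card_content, h]
  · ext s
    simp only [Finset.mem_filter, Finset.mem_powersetCard, Finset.mem_univ, Finset.subset_univ,
      true_and]
    exact ⟨fun h => ⟨by rw [Finset.card, h], h⟩, fun h => h.2⟩

theorem sum_primCycles_content_eq_zero (S : Matrix β β ℂ) {M : Multiset β} (hM : ¬ M.Nodup) :
    ∑ t ∈ (primCycles β (Multiset.card M)).powerset with content t = M,
        (-1) ^ t.card * ∏ c ∈ t, orbitAmplitude S c = 0 := by
  rw [sum_primCycles_content_eq, Finset.sum_eq_zero, mul_zero]
  intro s hs
  exact absurd ((Finset.mem_filter.1 hs).2 ▸ s.nodup) hM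

theorem sum_primCycles_content_eq_det (S : Matrix β β ℂ) (s : Finset β) :
    ∑ t ∈ (primCycles β s.card).powerset with content t = s.val,
        (-1) ^ t.card * ∏ c ∈ t, orbitAmplitude S c =
      (-1) ^ s.card * (S.submatrix (Subtype.val : s → β) (Subtype.val : s → β)).det := by
  rw [Finset.card, sum_primCycles_content_eq, Finset.sum_eq_single s]
  · intro s' hs' h
    exact absurd (Finset.val_injective (Finset.mem_filter.1 hs').2) h
  · simp

end Content

end CyclicWord

/-! ### The contribution as a principal minor. -/

namespace BinaryGraph

open CyclicWord

variable {V : ℕ}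

theorem pathAmplitude_ne_zero_isChain {β : Type*} {S : Matrix β β ℂ} {R : β → β → Prop}
    (hS : ∀ b b', S b' b ≠ 0 → R b b') {a : β} {t : List β} {b : β}
    (h : pathAmplitude S a t b ≠ 0) : List.IsChain R (a :: (t ++ [b])) := by
  induction t generalizing a with
  | nil => simpa using hS _ _ h
  | cons c t ih =>
    rw [pathAmplitude] at h
    exact List.isChain_cons_cons.2 ⟨hS _ _ (left_ne_zero_of_mul h), ih (right_ne_zero_of_mul h)⟩

/-- Cyclic words that do not follow the graph have amplitude zero, so they can be added to the sum
over partners. -/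
theorem isPeriodicOrbit_of_orbitAmplitude_ne_zero (ν : BondNumbering V) {c : Cycle (Bond V)}
    (hc : c ≠ Cycle.nil) (h : orbitAmplitude (bondScattering ν) c ≠ 0) : IsPeriodicOrbit c := by
  refine ⟨hc, ?_⟩
  induction c using Quotient.inductionOn with
  | _ l =>
    have hl : l ≠ [] := by rintro rfl; exact hc rfl
    obtain ⟨a, t, rfl⟩ := List.exists_cons_of_ne_nil hl
    change listAmplitude _ (a :: t) ≠ 0 at h
    rw [listAmplitude_cons] at h
    refine pathAmplitude_ne_zero_isChain (fun b b' hb => ?_) h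
    by_contra hne
    exact hb (if_neg hne)

theorem topLength_eq_card_content (γ : Finset (Cycle (Bond V))) :
    topLength γ = Multiset.card (content γ) := (card_content γ).symm

theorem metricLength_eq_sum_content (L : Bond V → ℝ) (γ : Finset (Cycle (Bond V))) :
    metricLength L γ = ((content γ).map L).sum := by
  classical
  rw [metricLength, content]
  induction γ using Finset.induction_on with
  | empty => simp
  | insert a t ha ih =>
    rw [Finset.sum_insert ha, Finset.sum_insert ha, Multiset.map_add, Multiset.sum_add, ih]

/-- The multiplicities are rational coefficients of the same vector in terms of `L`. -/
theorem eq_of_sum_map_eq {β : Type*} [Finite β] {L : β → ℝ} (hL : LinearIndependent ℚ L)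
    {M M' : Multiset β} (h : (M.map L).sum = (M'.map L).sum) : M = M' := by
  classical
  have := Fintype.ofFinite β
  have key : ∀ M : Multiset β, (M.map L).sum = ∑ b, (M.count b : ℚ) • L b := by
    intro M
    rw [Finset.sum_multiset_map_count]
    refine (Finset.sum_subset (Finset.subset_univ _) fun b _ hb => ?_).trans
      (Finset.sum_congr rfl fun b _ => (Nat.cast_smul_eq_nsmul ℚ _ _).symm)
    rw [Multiset.count_eq_zero.2 (by simpa using hb), zero_smul]
  rw [key, key, ← sub_eq_zero, ← Finset.sum_sub_distrib] at h
  simp_rw [← sub_smul] at h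
  ext b
  have := Fintype.linearIndependent_iff.1 hL _ h b
  exact_mod_cast sub_eq_zero.1 this

theorem mem_partners_iff {L : Bond V → ℝ} (hL : LinearIndependent ℚ L)
    {γ γ' : Finset (Cycle (Bond V))} :
    γ' ∈ partners L γ ↔ IsPrimitivePseudoOrbit γ' ∧ content γ' = content γ := by
  simp only [partners, Set.mem_ofPred_eq, metricLength_eq_sum_content, topLength_eq_card_content]
  refine and_congr_right fun _ => ⟨fun h => eq_of_sum_map_eq hL h.2, fun h => ?_⟩
  rw [h]
  exact ⟨rfl, rfl⟩

open Classical in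
theorem contribution_eq {L : Bond V → ℝ} (hL : LinearIndependent ℚ L) (ν : BondNumbering V)
    (γ : Finset (Cycle (Bond V))) :
    contribution L ν γ = (-1) ^ γ.card * amplitude ν γ * (starRingEnd ℂ)
      (∑ t ∈ (primCycles (Bond V) (Multiset.card (content γ))).powerset with
        content t = content γ, (-1) ^ t.card * ∏ c ∈ t, orbitAmplitude (bondScattering ν) c) := by
  rw [contribution, map_sum, Finset.mul_sum]
  refine (Finset.sum_subset ?_ ?_).trans (Finset.sum_congr rfl fun t _ => ?_)
  · intro t ht
    rw [Set.Finite.mem_toFinset, mem_partners_iff hL] at ht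
    rw [Finset.mem_filter, Finset.mem_powerset]
    refine ⟨fun c hc => mem_primCycles.2 ⟨(ht.1 c hc).2, ?_⟩, ht.2⟩
    rw [← ht.2, card_content]
    exact Finset.single_le_sum (f := fun c : Cycle (Bond V) => c.length)
      (fun _ _ => Nat.zero_le _) hc
  · intro t ht hnt
    rw [Finset.mem_filter, Finset.mem_powerset] at ht
    rw [Set.Finite.mem_toFinset, mem_partners_iff hL] at hnt
    have h0 : amplitude ν t = 0 := by
      by_contra h
      refine hnt ⟨fun c hc => ?_, ht.2⟩
      have hp := (mem_primCycles.1 (ht.1 hc)).1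
      exact ⟨isPeriodicOrbit_of_orbitAmplitude_ne_zero ν (isPrimitive_ne_nil hp)
        (Finset.prod_ne_zero_iff.1 h c hc), hp⟩
    rw [h0, map_zero, mul_zero]
  · rw [amplitude, amplitude, pow_add, map_mul, map_pow, map_neg, map_one]
    ring

/-- A pseudo orbit that uses a bond more than once does not contribute. -/
theorem contribution_eq_zero {L : Bond V → ℝ} (hL : LinearIndependent ℚ L) (ν : BondNumbering V)
    {γ : Finset (Cycle (Bond V))} (h : ¬ (content γ).Nodup) : contribution L ν γ = 0 := by
  classical
  have := Fintype.ofFinite (Bond V)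
  have h0 := sum_primCycles_content_eq_zero (bondScattering ν) h
  rw [contribution_eq hL, h0, map_zero, mul_zero]

theorem contribution_eq_det [Fintype (Bond V)] {L : Bond V → ℝ}
    (hL : LinearIndependent ℚ L) (ν : BondNumbering V) {γ : Finset (Cycle (Bond V))}
    {s : Finset (Bond V)} (h : content γ = s.val) :
    contribution L ν γ = (-1) ^ γ.card * amplitude ν γ * (starRingEnd ℂ) ((-1) ^ s.card *
      ((bondScattering ν).submatrix (Subtype.val : s → Bond V)
        (Subtype.val : s → Bond V)).det) := by
  classical
  rw [contribution_eq hL, h, ← sum_primCycles_content_eq_det]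
  rfl

end BinaryGraph

/-! ### Rotations of cyclic words under maps. -/

namespace CyclicWord

variable {α β : Type*}

theorem cyclicPermutations_map (f : α → β) (l : List α) :
    (l.map f).cyclicPermutations = l.cyclicPermutations.map (List.map f) := by
  rcases eq_or_ne l [] with rfl | hl
  · simp
  refine List.ext_getElem ?_ fun i _ _ => ?_
  · rw [List.length_cyclicPermutations_of_ne_nil _ (by simpa using hl), List.length_map,
      List.length_map, List.length_cyclicPermutations_of_ne_nil _ hl]
  · simp [List.map_rotate]

theorem lists_map (f : α → β) (c : Cycle α) : (c.map f).lists = c.lists.map (List.map f) := by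
  induction c using Quotient.inductionOn with
  | _ l =>
    change Cycle.lists ((l.map f : List β) : Cycle β) = (Cycle.lists (l : Cycle α)).map _
    rw [Cycle.lists_coe, Cycle.lists_coe, cyclicPermutations_map, Multiset.map_coe]

theorem map_head?_lists (c : Cycle α) (hc : c ≠ Cycle.nil) :
    c.lists.map List.head? = c.toMultiset.map some := by
  induction c using Quotient.inductionOn with
  | _ l =>
    have hl : l ≠ [] := by rintro rfl; exact hc rfl
    change (Cycle.lists (l : Cycle α)).map _ = (Cycle.toMultiset (l : Cycle α)).map _
    rw [Cycle.lists_coe, Cycle.coe_toMultiset, Multiset.map_coe, Multiset.map_coe]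
    congr 1
    refine List.ext_getElem ?_ fun i _ h => ?_
    · simp [List.length_cyclicPermutations_of_ne_nil _ hl]
    · have hi : i < l.length := by simpa using h
      simp [List.head?_rotate hi, hi]

theorem map_rot (f : α → β) (l : List α) : (rot l).map f = rot (l.map f) := List.map_rotate f l 1

theorem coe_rot (l : List α) : ((rot l : List α) : Cycle α) = l :=
  Cycle.coe_eq_coe.2 (List.IsRotated.forall l 1)

theorem exists_rot_eq (l : List α) : ∃ l', rot l' = l ∧ (l' : Cycle α) = l := by
  refine ⟨l.rotate (l.length - 1), ?_, Cycle.coe_eq_coe.2 (List.IsRotated.forall l _)⟩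
  rcases eq_or_ne l [] with rfl | hl
  · rfl
  · rw [rot, List.rotate_rotate, Nat.sub_add_cancel (List.length_pos_of_ne_nil hl),
      List.rotate_length]

theorem rel_head_head_rot {R : α → α → Prop} {l : List α} (hl : l ≠ [])
    (h : Cycle.Chain R (l : Cycle α)) : R (l.head hl) ((rot l).head (rot_ne_nil hl)) := by
  obtain ⟨a, t, rfl⟩ := List.exists_cons_of_ne_nil hl
  rw [Cycle.chain_coe_cons] at h
  rcases t with _ | ⟨b, t⟩
  · simpa [rot] using h
  · rw [List.cons_append, List.isChain_cons_cons] at h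
    simpa [rot] using h.1

end CyclicWord

/-! ### Encounters and repeated bonds. -/

namespace BinaryGraph

open CyclicWord

variable {V : ℕ}

open Classical in
/-- The words that represent the orbits of `γ`: one for every position in `γ`. -/
noncomputable def positions (γ : Finset (Cycle (Bond V))) : Finset (List (Bond V)) :=
  (γ.val.bind Cycle.lists).toFinset

theorem mem_positions {γ : Finset (Cycle (Bond V))} {l : List (Bond V)} :
    l ∈ positions γ ↔ (l : Cycle (Bond V)) ∈ γ := by
  simp [positions, Cycle.mem_lists_iff_coe_eq]

theorem rot_mem_positions {γ : Finset (Cycle (Bond V))} {l : List (Bond V)}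
    (hl : l ∈ positions γ) : rot l ∈ positions γ := by
  rw [mem_positions, coe_rot]
  exact mem_positions.1 hl

theorem exists_rot_mem_positions {γ : Finset (Cycle (Bond V))} {l : List (Bond V)}
    (hl : l ∈ positions γ) : ∃ l₁ ∈ positions γ, rot l₁ = l := by
  obtain ⟨l₁, h1, h2⟩ := exists_rot_eq l
  exact ⟨l₁, mem_positions.2 (h2 ▸ mem_positions.1 hl), h1⟩

theorem length_le_topLength {γ : Finset (Cycle (Bond V))} {l : List (Bond V)}
    (hl : l ∈ positions γ) : l.length ≤ topLength γ :=
  Finset.single_le_sum (f := fun c : Cycle (Bond V) => c.length)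
    (fun _ _ => Nat.zero_le _) (mem_positions.1 hl)

/-- Rotations of a primitive word are pairwise distinct, so a position is the same thing as a word
and deduplication loses no multiplicity. -/
theorem positions_val {γ : Finset (Cycle (Bond V))} (hγ : IsPrimitivePseudoOrbit γ) :
    (positions γ).val = ∑ c ∈ γ, c.lists := by
  classical
  rw [positions, Multiset.toFinset_val, Multiset.dedup_eq_self.2]
  · rfl
  · rw [Multiset.nodup_bind]
    refine ⟨fun c hc => nodup_lists (hγ c hc).2, γ.nodup.pairwise fun c _ d _ hcd => ?_⟩
    rw [Function.onFun, Multiset.disjoint_left]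
    intro l hc hd
    rw [Cycle.mem_lists_iff_coe_eq] at hc hd
    exact hcd (hc.symm.trans hd)

section Positions

variable {γ : Finset (Cycle (Bond V))} (hγ : IsPrimitivePseudoOrbit γ) {l l' : List (Bond V)}

include hγ

theorem ne_nil_of_mem_positions (hl : l ∈ positions γ) : l ≠ [] :=
  (isPrimitive_coe_iff.1 (hγ _ (mem_positions.1 hl)).2).1

theorem map_ne_nil_of_mem_positions (hl : l ∈ positions γ) : l.map origin ≠ [] := by
  simpa using ne_nil_of_mem_positions hγ hl

theorem map_some_content :
    (content γ).map some = (positions γ).val.map List.head? := by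
  rw [positions_val hγ, content, ← Multiset.coe_mapAddMonoidHom, ← Multiset.coe_mapAddMonoidHom,
    map_sum, map_sum]
  exact Finset.sum_congr rfl fun c hc => (map_head?_lists c (hγ c hc).1.1).symm

theorem content_nodup_iff :
    (content γ).Nodup ↔ ∀ l ∈ positions γ, ∀ l' ∈ positions γ, l.head? = l'.head? → l = l' := by
  rw [← Multiset.nodup_map_iff_of_injective (Option.some_injective _), map_some_content hγ,
    Multiset.nodup_map_iff_inj_on (positions γ).nodup]
  rfl

theorem vertexWindows_eq (m : ℕ) :
    vertexWindows m γ = (positions γ).val.map fun l => window m (l.map origin) := by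
  rw [positions_val hγ, vertexWindows, ← Multiset.coe_mapAddMonoidHom, map_sum]
  refine Finset.sum_congr rfl fun c _ => ?_
  rw [windows, lists_map, Multiset.map_map]
  rfl

theorem mem_vertexWindows {m : ℕ} {e : List (Fin V)} :
    e ∈ vertexWindows m γ ↔ ∃ l ∈ positions γ, window m (l.map origin) = e := by
  rw [vertexWindows_eq hγ, Multiset.mem_map]
  rfl

theorem occurrences_eq (e : List (Fin V)) :
    occurrences γ e = {l ∈ positions γ | window e.length (l.map origin) = e}.card := by
  rw [occurrences, vertexWindows_eq hγ, Multiset.count_map]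
  simp only [Finset.card, Finset.filter_val, eq_comm]

theorem occurrences_singleton (v : Fin V) :
    occurrences γ [v] = (content γ).countP (origin · = v) := by
  have h : vertexWindows 1 γ = (content γ).map fun b => [origin b] := by
    have h1 := congrArg (Multiset.map fun o : Option (Bond V) => o.elim [] fun b => [origin b])
      (map_some_content hγ)
    rw [Multiset.map_map, Multiset.map_map] at h1
    rw [vertexWindows_eq hγ]
    refine Eq.trans (Multiset.map_congr rfl fun l hl => ?_) h1.symm
    obtain ⟨a, t, rfl⟩ := List.exists_cons_of_ne_nil (ne_nil_of_mem_positions hγ hl)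
    simp [window_succ_cons]
  rw [occurrences, List.length_singleton, h, Multiset.count_map, ← Multiset.countP_eq_card_filter]
  simp [eq_comm]

theorem two_le_occurrences (hl : l ∈ positions γ) (hl' : l' ∈ positions γ) (hne : l ≠ l') {m : ℕ}
    (h : window m (l.map origin) = window m (l'.map origin)) :
    2 ≤ occurrences γ (window m (l.map origin)) := by
  rw [occurrences_eq hγ, length_window (map_ne_nil_of_mem_positions hγ hl)]
  exact Finset.one_lt_card.2 ⟨l, by simp [hl], l', by simp [hl', h], hne⟩

theorem exists_of_two_le_occurrences {e : List (Fin V)} (h : 2 ≤ occurrences γ e) :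
    ∃ l ∈ positions γ, ∃ l' ∈ positions γ, l ≠ l' ∧
      window e.length (l.map origin) = e ∧ window e.length (l'.map origin) = e := by
  rw [occurrences_eq hγ] at h
  obtain ⟨l, hl, l', hl', hne⟩ := Finset.one_lt_card.1 h
  rw [Finset.mem_filter] at hl hl'
  exact ⟨l, hl.1, l', hl'.1, hne, hl.2, hl'.2⟩

theorem terminus_head (hl : l ∈ positions γ) :
    terminus (l.head (ne_nil_of_mem_positions hγ hl)) =
      origin ((rot l).head (rot_ne_nil (ne_nil_of_mem_positions hγ hl))) :=
  rel_head_head_rot (ne_nil_of_mem_positions hγ hl) (hγ _ (mem_positions.1 hl)).1.2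

theorem window_one (hl : l ∈ positions γ) :
    window 1 (l.map origin) = [origin (l.head (ne_nil_of_mem_positions hγ hl))] := by
  rw [window_succ (map_ne_nil_of_mem_positions hγ hl), window_zero, List.head_map]

theorem window_succ_map_origin (hl : l ∈ positions γ) (m : ℕ) :
    window (m + 1) (l.map origin) =
      origin (l.head (ne_nil_of_mem_positions hγ hl)) :: window m ((rot l).map origin) := by
  rw [window_succ (map_ne_nil_of_mem_positions hγ hl), List.head_map, map_rot]

theorem window_two (hl : l ∈ positions γ) :
    window 2 (l.map origin) = [origin (l.head (ne_nil_of_mem_positions hγ hl)),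
      terminus (l.head (ne_nil_of_mem_positions hγ hl))] := by
  rw [window_succ_map_origin hγ hl, window_one hγ (rot_mem_positions hl), terminus_head hγ hl]

/-- The graph has no multiple bonds: two consecutive vertices determine the bond between them. -/
theorem head_eq_of_window_two_eq (hl : l ∈ positions γ) (hl' : l' ∈ positions γ)
    (h : window 2 (l.map origin) = window 2 (l'.map origin)) : l.head? = l'.head? := by
  rw [window_two hγ hl, window_two hγ hl', List.cons.injEq, List.cons.injEq] at h
  rw [List.head?_eq_some_head (ne_nil_of_mem_positions hγ hl),
    List.head?_eq_some_head (ne_nil_of_mem_positions hγ hl')]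
  exact congrArg some (Subtype.ext (Prod.ext h.1 h.2.1))

theorem window_eq_of_window_map_origin_eq (hl : l ∈ positions γ) (hl' : l' ∈ positions γ) {m : ℕ}
    (h : window (m + 1) (l.map origin) = window (m + 1) (l'.map origin)) :
    window m l = window m l' := by
  induction m generalizing l l' with
  | zero => simp
  | succ m ih =>
    have h2 : window 2 (l.map origin) = window 2 (l'.map origin) := by
      rw [← take_window (map_ne_nil_of_mem_positions hγ hl) (by omega : 2 ≤ m + 1 + 1), h,
        take_window (map_ne_nil_of_mem_positions hγ hl') (by omega)]
    have h3 := head_eq_of_window_two_eq hγ hl hl' h2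
    rw [List.head?_eq_some_head (ne_nil_of_mem_positions hγ hl),
      List.head?_eq_some_head (ne_nil_of_mem_positions hγ hl'), Option.some_inj] at h3
    rw [window_succ_map_origin hγ hl, window_succ_map_origin hγ hl', List.cons.injEq] at h
    rw [window_succ (ne_nil_of_mem_positions hγ hl), window_succ (ne_nil_of_mem_positions hγ hl'),
      h3, ih (rot_mem_positions hl) (rot_mem_positions hl') h.2]

/-- A longer repeated sequence would fix at least `topLength γ * topLength γ` common bonds, enough
to force two primitive words to coincide. -/
theorem length_le_of_two_le_occurrences {e : List (Fin V)} (h : 2 ≤ occurrences γ e) :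
    e.length ≤ topLength γ * topLength γ := by
  by_contra! hlt
  obtain ⟨l, hl, l', hl', hne, h1, h2⟩ := exists_of_two_le_occurrences hγ h
  obtain ⟨m, hm⟩ := Nat.exists_eq_succ_of_ne_zero (by omega : e.length ≠ 0)
  refine hne (eq_of_window_eq (hγ _ (mem_positions.1 hl)).2 (hγ _ (mem_positions.1 hl')).2 ?_
    (window_eq_of_window_map_origin_eq hγ hl hl' (m := m) ?_))
  · have := Nat.mul_le_mul (length_le_topLength hl) (length_le_topLength hl')
    omega
  · rw [← Nat.succ_eq_add_one, ← hm, h1, h2]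

/-- A pseudo orbit that uses a bond more than once has an encounter of positive length. -/
theorem exists_encounter_of_not_nodup (h : ¬ (content γ).Nodup) :
    ∃ e ∈ encounters γ, 2 ≤ e.length := by
  classical
  rw [content_nodup_iff hγ] at h
  push Not at h
  obtain ⟨l, hl, l', hl', hhead, hne⟩ := h
  -- A repeated bond is a repeated sequence of two vertices. In a longest repeated sequence, equal
  -- neighbours on either side would allow an extension.
  let P : ℕ → Prop := fun m => ∃ e : List (Fin V), e.length = m ∧ 2 ≤ occurrences γ e
  have hP2 : P 2 := by
    refine ⟨_, length_window (map_ne_nil_of_mem_positions hγ hl) 2,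
      two_le_occurrences hγ hl hl' hne ?_⟩
    rw [window_two hγ hl, window_two hγ hl']
    rw [List.head?_eq_some_head (ne_nil_of_mem_positions hγ hl),
      List.head?_eq_some_head (ne_nil_of_mem_positions hγ hl'), Option.some_inj] at hhead
    rw [hhead]
  have hbound : ∀ m, P m → m ≤ topLength γ * topLength γ := by
    rintro m ⟨e, rfl, he⟩
    exact length_le_of_two_le_occurrences hγ he
  obtain ⟨e, he, hocc⟩ := Nat.findGreatest_spec (hbound 2 hP2) hP2
  have h2 : 2 ≤ e.length := he ▸ Nat.le_findGreatest (hbound 2 hP2) hP2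
  have hmax : ¬ P (e.length + 1) := fun hP =>
    Nat.findGreatest_is_greatest (he ▸ Nat.lt_succ_self _) (hbound _ hP) hP
  clear hne hhead hl hl'
  obtain ⟨l, hl, l', hl', hne, hw, hw'⟩ := exists_of_two_le_occurrences hγ hocc
  have hmax' : ∀ k ∈ positions γ, ∀ k' ∈ positions γ, k ≠ k' →
      window (e.length + 1) (k.map origin) ≠ window (e.length + 1) (k'.map origin) :=
    fun k hk k' hk' hkne hkw => hmax ⟨_, length_window (map_ne_nil_of_mem_positions hγ hk) _,
      two_le_occurrences hγ hk hk' hkne hkw⟩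
  refine ⟨e, ⟨fun h0 => by simp [h0] at h2, hocc, ?_, ?_⟩, h2⟩
  · obtain ⟨k, hk, rfl⟩ := exists_rot_mem_positions hl
    obtain ⟨k', hk', rfl⟩ := exists_rot_mem_positions hl'
    have h3 := hmax' k hk k' hk' fun h => hne (by rw [h])
    have h4 := window_succ_map_origin hγ hk e.length
    have h5 := window_succ_map_origin hγ hk' e.length
    rw [hw] at h4
    rw [hw'] at h5
    refine ⟨_, _, fun h => h3 ?_, (mem_vertexWindows hγ).2 ⟨k, hk, h4⟩,
      (mem_vertexWindows hγ).2 ⟨k', hk', h5⟩⟩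
    rw [h4, h5, h]
  · have h3 := hmax' l hl l' hl' hne
    have h4 : ∀ k ∈ positions γ, window e.length (k.map origin) = e →
        ∃ f, window (e.length + 1) (k.map origin) = e ++ [f] := by
      intro k hk hkw
      have h0 := map_ne_nil_of_mem_positions hγ hk
      rw [window_add h0, hkw, window_succ (rot_iterate_ne_nil h0 _)]
      exact ⟨_, rfl⟩
    obtain ⟨f, hf⟩ := h4 l hl hw
    obtain ⟨f', hf'⟩ := h4 l' hl' hw'
    refine ⟨f, f', fun h => h3 ?_, (mem_vertexWindows hγ).2 ⟨l, hl, hf⟩,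
      (mem_vertexWindows hγ).2 ⟨l', hl', hf'⟩⟩
    rw [hf, hf', h]

/-- A pseudo orbit with a vertex sequence of positive length that appears twice, or with a vertex
that appears three times, uses a bond more than once. -/
theorem not_nodup_of_occurrences (ν : BondNumbering V) {e : List (Fin V)} (he : e ≠ [])
    (h2 : 2 ≤ occurrences γ e) (h : 2 ≤ e.length ∨ 3 ≤ occurrences γ e) :
    ¬ (content γ).Nodup := by
  rw [content_nodup_iff hγ]
  intro hinj
  rcases h with h | h
  · obtain ⟨l, hl, l', hl', hne, hw, hw'⟩ := exists_of_two_le_occurrences hγ h2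
    refine hne (hinj l hl l' hl' (head_eq_of_window_two_eq hγ hl hl' ?_))
    rw [← take_window (map_ne_nil_of_mem_positions hγ hl) h, hw,
      ← take_window (map_ne_nil_of_mem_positions hγ hl') h, hw']
  · obtain ⟨v, t, rfl⟩ := List.exists_cons_of_ne_nil he
    rw [occurrences_eq hγ] at h
    -- Pigeonhole: three positions start at the vertex `v`, whose outgoing bonds have only two
    -- numbers.
    have hcard : ((Finset.univ : Finset (Fin 2)).map Function.Embedding.some).card <
        {l ∈ positions γ | window (v :: t).length (l.map origin) = v :: t}.card := by
      rw [Finset.card_map, Finset.card_univ, Fintype.card_fin]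
      omega
    obtain ⟨l, hl, l', hl', hne, heq⟩ := Finset.exists_ne_map_eq_of_card_lt_of_maps_to hcard
      (f := fun l => l.head?.map ν.outIdx) fun l hl => by
        rw [Finset.mem_coe, Finset.mem_filter] at hl
        simp [List.head?_eq_some_head (ne_nil_of_mem_positions hγ hl.1)]
    rw [Finset.mem_filter] at hl hl'
    have h1 := hl.2
    have h2 := hl'.2
    rw [List.length_cons, window_succ_map_origin hγ hl.1, List.cons.injEq] at h1
    rw [List.length_cons, window_succ_map_origin hγ hl'.1, List.cons.injEq] at h2
    refine hne (hinj l hl.1 l' hl'.1 ?_)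
    simp only [List.head?_eq_some_head (ne_nil_of_mem_positions hγ hl.1),
      List.head?_eq_some_head (ne_nil_of_mem_positions hγ hl'.1), Option.map_some,
      Option.some_inj] at heq ⊢
    exact ν.outIdx_inj _ _ (h1.1.trans h2.1.symm) heq

/-- A vertex that is passed twice, by different bonds, is an encounter. -/
theorem singleton_mem_encounters (hnd : (content γ).Nodup) {v : Fin V}
    (h : 2 ≤ occurrences γ [v]) : [v] ∈ encounters γ := by
  obtain ⟨l, hl, l', hl', hne, hw, hw'⟩ := exists_of_two_le_occurrences hγ h
  rw [content_nodup_iff hγ] at hnd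
  have hh : ∀ k (hk : k ∈ positions γ) k' (hk' : k' ∈ positions γ), k ≠ k' →
      k.head (ne_nil_of_mem_positions hγ hk) ≠ k'.head (ne_nil_of_mem_positions hγ hk') := by
    intro k hk k' hk' hkne heq
    refine hkne (hnd k hk k' hk' ?_)
    rw [List.head?_eq_some_head (ne_nil_of_mem_positions hγ hk),
      List.head?_eq_some_head (ne_nil_of_mem_positions hγ hk'), heq]
  rw [List.length_singleton] at hw hw'
  refine ⟨by simp, h, ?_, ?_⟩
  -- Both preceding bonds end at `v`, so equal origins would make them the same bond, against `hnd`;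
  -- the following bonds are treated alike.
  · obtain ⟨k, hk, rfl⟩ := exists_rot_mem_positions hl
    obtain ⟨k', hk', rfl⟩ := exists_rot_mem_positions hl'
    have h4 := window_succ_map_origin hγ hk 1
    have h5 := window_succ_map_origin hγ hk' 1
    rw [hw] at h4
    rw [hw'] at h5
    refine ⟨_, _, fun h => hh k hk k' hk' (fun h => hne (by rw [h])) (Subtype.ext (Prod.ext h ?_)),
      (mem_vertexWindows hγ).2 ⟨k, hk, h4⟩, (mem_vertexWindows hγ).2 ⟨k', hk', h5⟩⟩
    rw [window_one hγ hl, List.cons.injEq] at hw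
    rw [window_one hγ hl', List.cons.injEq] at hw'
    exact (terminus_head hγ hk).trans ((hw.1.trans hw'.1.symm).trans (terminus_head hγ hk').symm)
  · rw [window_one hγ hl, List.cons.injEq] at hw
    rw [window_one hγ hl', List.cons.injEq] at hw'
    have h4 := window_two hγ hl
    have h5 := window_two hγ hl'
    rw [hw.1] at h4
    rw [hw'.1] at h5
    exact ⟨_, _, fun h => hh l hl l' hl' hne (Subtype.ext (Prod.ext (hw.1.trans hw'.1.symm) h)),
      (mem_vertexWindows hγ).2 ⟨l, hl, h4⟩, (mem_vertexWindows hγ).2 ⟨l', hl', h5⟩⟩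

/-- An encounter of length zero is a single vertex, and a vertex is visited as often as `γ` uses
bonds leaving it. -/
theorem encard_encounters (hnd : (content γ).Nodup)
    (h : ∀ e ∈ encounters γ, occurrences γ e = 2 ∧ encounterLength e = 0) :
    (encounters γ).encard =
      ({v : Fin V | (content γ).countP (origin · = v) = 2} : Finset (Fin V)).card := by
  have h1 : encounters γ = (fun v => [v]) ''
      (({v : Fin V | (content γ).countP (origin · = v) = 2} : Finset (Fin V)) : Set (Fin V)) := by
    ext e
    simp only [Set.mem_image, Finset.mem_coe, Finset.mem_filter_univ, ← occurrences_singleton hγ]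
    constructor
    · intro he
      obtain ⟨ho, hl⟩ := h e he
      have hne : e ≠ [] := he.1
      have := List.length_pos_of_ne_nil hne
      rw [encounterLength] at hl
      obtain ⟨v, rfl⟩ := List.length_eq_one_iff.1 (by omega : e.length = 1)
      exact ⟨v, ho, rfl⟩
    · rintro ⟨v, hv, rfl⟩
      exact singleton_mem_encounters hγ hnd hv.ge
  rw [h1, Function.Injective.encard_image (fun v w h => by simpa using h),
    Set.encard_coe_eq_coe_finsetCard]

end Positions

end BinaryGraph

/-! ### The permutation sending each bond to its successor. -/

namespace CyclicWord

open BinaryGraph Equiv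

section Permutation

variable {β : Type*} [DecidableEq β]

theorem map_formPerm {l : List β} (h : l.Nodup) : l.map l.formPerm = l.rotate 1 := by
  refine List.ext_getElem (by simp) fun i _ _ => ?_
  rw [List.getElem_map, List.formPerm_apply_getElem _ h, List.getElem_rotate]

theorem listAmplitude_eq_prod_map_formPerm (S : Matrix β β ℂ) {l : List β} (h : l.Nodup) :
    listAmplitude S l = (l.map fun b => S (l.formPerm b) b).prod := by
  rw [listAmplitude, ← map_formPerm h, List.zipWith_map_right, List.zipWith_self]

theorem rel_formPerm {R : β → β → Prop} {l : List β} (h : l.Nodup)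
    (hR : Cycle.Chain R (l : Cycle β)) {b : β} (hb : b ∈ l) : R b (l.formPerm b) := by
  obtain ⟨s, t, rfl⟩ := List.append_of_mem hb
  have hrot : s ++ b :: t ~r b :: t ++ s := List.isRotated_append
  rw [List.formPerm_eq_of_isRotated h hrot]
  rw [Cycle.coe_eq_coe.2 hrot] at hR
  have h1 := map_formPerm (hrot.nodup_iff.1 h)
  have h2 := rel_head_head_rot (by simp) hR
  rw [List.cons_append, List.map_cons] at h1
  simpa [rot, ← h1] using h2

variable [Fintype β]

/-- A one-letter word is treated apart: its `formPerm` is the identity, which is not a cycle. -/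
theorem sign_formPerm {l : List β} (h : l.Nodup) (hl : l ≠ []) :
    Perm.sign l.formPerm = (-1) ^ (l.length + 1) := by
  obtain ⟨a, t, rfl⟩ := List.exists_cons_of_ne_nil hl
  rcases t with _ | ⟨b, t⟩
  · simp
  · rw [(List.isCycle_formPerm h (by simp)).sign,
      List.support_formPerm_of_nodup _ h (by simp), List.toFinset_card_of_nodup h, pow_succ]
    simp

/-- The permutation of the letters that belongs to a set of cyclic words without repeated
letters: it sends every letter to the following one. -/
theorem exists_perm_of_content_nodup {γ : Finset (Cycle β)} (hγ : ∀ c ∈ γ, c ≠ Cycle.nil)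
    (hnd : (content γ).Nodup) :
    ∃ σ : Perm β, Perm.sign σ = (-1) ^ (Multiset.card (content γ) + γ.card) ∧
      (∀ b, b ∉ content γ → σ b = b) ∧
      (∀ S : Matrix β β ℂ, ∏ c ∈ γ, orbitAmplitude S c =
        ((content γ).map fun b => S (σ b) b).prod) ∧
      ∀ R : β → β → Prop, (∀ c ∈ γ, c.Chain R) → ∀ b ∈ content γ, R b (σ b) := by
  induction γ using Finset.induction_on with
  | empty => exact ⟨1, by simp [content]⟩
  | insert c γ hc ih =>
    have hcont : content (insert c γ) = c.toMultiset + content γ := by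
      rw [content, Finset.sum_insert hc, content]
    rw [hcont] at hnd ⊢
    obtain ⟨hnd1, hnd2, hdisj⟩ := Multiset.nodup_add.1 hnd
    obtain ⟨σ, hsign, hfix, hprod, hrel⟩ :=
      ih (fun d hd => hγ d (Finset.mem_insert_of_mem hd)) hnd2
    have hmem : ∀ b ∈ content γ, σ b ∈ content γ := by
      intro b hb
      by_contra h
      rw [σ.injective (hfix _ h)] at h
      exact h hb
    induction c using Quotient.inductionOn with
    | _ l =>
      have hl : l ≠ [] := by
        rintro rfl
        exact hγ _ (Finset.mem_insert_self _ _) rfl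
      change (Cycle.toMultiset (l : Cycle β)).Nodup at hnd1
      change Disjoint (Cycle.toMultiset (l : Cycle β)) _ at hdisj
      change ∃ τ : Perm β, Perm.sign τ =
        (-1) ^ (Multiset.card (Cycle.toMultiset (l : Cycle β) + content γ) + _) ∧
        (∀ b, b ∉ Cycle.toMultiset (l : Cycle β) + content γ → _) ∧
        (∀ S : Matrix β β ℂ, _ =
          ((Cycle.toMultiset (l : Cycle β) + content γ).map fun b => S (τ b) b).prod) ∧
        ∀ R : β → β → Prop, _ → ∀ b ∈ Cycle.toMultiset (l : Cycle β) + content γ, _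
      rw [Cycle.coe_toMultiset] at hnd1 hdisj ⊢
      rw [Multiset.coe_nodup] at hnd1
      rw [Multiset.disjoint_left] at hdisj
      -- The new cycle and `σ` move disjoint sets of letters, so each acts alone on its own letters.
      have hin : ∀ b ∈ l, (l.formPerm * σ) b = l.formPerm b := fun b hb => by
        rw [Perm.mul_apply, hfix b (hdisj hb)]
      have hout : ∀ b ∈ content γ, (l.formPerm * σ) b = σ b := fun b hb => by
        rw [Perm.mul_apply, List.formPerm_apply_of_notMem]
        exact fun h => hdisj h (hmem b hb)
      refine ⟨l.formPerm * σ, ?_, ?_, ?_, ?_⟩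
      · rw [map_mul, hsign, sign_formPerm hnd1 hl, Finset.card_insert_of_notMem hc,
          Multiset.card_add, Multiset.coe_card, ← pow_add]
        congr 1
        omega
      · intro b hb
        rw [Multiset.mem_add, not_or] at hb
        rw [Perm.mul_apply, hfix b hb.2, List.formPerm_apply_of_notMem hb.1]
      · intro S
        rw [Finset.prod_insert hc, hprod, Multiset.map_add, Multiset.prod_add]
        congr 1
        · refine (listAmplitude_eq_prod_map_formPerm S hnd1).trans ?_
          rw [Multiset.map_coe, Multiset.prod_coe]
          exact congrArg List.prod (List.map_congr_left fun b hb => by rw [hin b hb])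
        · exact congrArg Multiset.prod (Multiset.map_congr rfl fun b hb => by rw [hout b hb])
      · intro R hR b hb
        rw [Multiset.mem_add] at hb
        rcases hb with hb | hb
        · rw [hin b hb]
          exact rel_formPerm hnd1 (hR _ (Finset.mem_insert_self _ _)) hb
        · rw [hout b hb]
          exact hrel R (fun d hd => hR d (Finset.mem_insert_of_mem hd)) b hb

end Permutation

end CyclicWord

/-! ### Evaluating the minor vertex by vertex. -/

namespace BinaryGraph

open CyclicWord Equiv

/-- Exactly one of the four entries is negative, so the diagonal and antidiagonal products are
opposite and the determinant does not cancel. -/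
theorem dft_mul_sub_mul {i i' j j' : Fin 2} (hi : i ≠ i') (hj : j ≠ j') :
    dft i j * dft i' j' - dft i j' * dft i' j = 2 * (dft i j * dft i' j') := by
  fin_cases i <;> fin_cases i' <;> fin_cases j <;> fin_cases j' <;>
    simp [dft] at hi hj ⊢ <;> ring

theorem dft_mul_conj (i j : Fin 2) : dft i j * (starRingEnd ℂ) (dft i j) = 1 / 2 := by
  have h : ((Real.sqrt 2 : ℝ) : ℂ) * (Real.sqrt 2 : ℝ) = 2 := by
    rw [← Complex.ofReal_mul, Real.mul_self_sqrt (by norm_num)]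
    norm_num
  have h2 : ((Real.sqrt 2 : ℝ) : ℂ)⁻¹ * ((Real.sqrt 2 : ℝ) : ℂ)⁻¹ = 1 / 2 := by
    rw [← mul_inv, h, one_div]
  fin_cases i <;> fin_cases j <;> simpa [dft, Complex.conj_ofReal] using h2

/-- A square block of the scattering matrix of a vertex has a determinant all of whose terms are
equal. -/
theorem det_dft_block {ι : Type*} [Fintype ι] [DecidableEq ι] {f g : ι → Fin 2}
    (hf : Function.Injective f) (hg : Function.Injective g) :
    (Matrix.of fun a b => dft (f a) (g b)).det =
      (if Fintype.card ι = 2 then 2 else 1) * ∏ a, dft (f a) (g a) := by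
  have hcard := Fintype.card_le_of_injective f hf
  rw [Fintype.card_fin] at hcard
  interval_cases h : Fintype.card ι
  · have := Fintype.card_eq_zero_iff.1 h
    simp
  · obtain ⟨x, hx⟩ := Fintype.card_eq_one_iff.1 h
    have : Unique ι := ⟨⟨x⟩, hx⟩
    simp [Matrix.det_unique]
  · let e : Fin 2 ≃ ι := (Fintype.equivFinOfCardEq h).symm
    rw [← Matrix.det_submatrix_equiv_self e, Matrix.det_fin_two, ← e.prod_comp, Fin.prod_univ_two,
      if_pos rfl]
    exact dft_mul_sub_mul (hf.ne (e.injective.ne (by decide))) (hg.ne (e.injective.ne (by decide)))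

variable {V : ℕ}

/-- The minor of the scattering matrix that belongs to a permutation of a set of bonds that
follows the graph. -/
theorem det_submatrix_bondScattering [Fintype (Bond V)] (ν : BondNumbering V) {s : Finset (Bond V)}
    (σ : Perm s) (hσ : ∀ a : s, terminus a.1 = origin (σ a).1) :
    ((bondScattering ν).submatrix (Subtype.val : s → Bond V) (Subtype.val : s → Bond V)).det =
      (Perm.sign σ : ℤ) * (2 ^ ({v : Fin V | Fintype.card {a : s // origin a.1 = v} = 2} :
        Finset (Fin V)).card * ∏ a : s, bondScattering ν (σ a) a) := by
  set M := (bondScattering ν).submatrix (Subtype.val : s → Bond V) (Subtype.val : s → Bond V)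
    with hM
  -- Row `a` now belongs to the successor of `a`, so an entry vanishes unless both bonds end at the
  -- same vertex.
  let T : Matrix s s ℂ := M.submatrix σ id
  have hT : ∀ a b : s, T a b =
      if terminus b.1 = terminus a.1 then dft (ν.outIdx (σ a)) (ν.inIdx b) else 0 := by
    intro a b
    rw [hσ a]
    rfl
  have hdet : M.det = (Perm.sign σ : ℤ) * T.det := by
    rw [Matrix.det_permute, ← mul_assoc, ← Int.cast_mul, ← Units.val_mul, Int.units_mul_self]
    simp
  have htri : T.BlockTriangular fun a : s => terminus a.1 := by
    intro a b hab
    rw [hT, if_neg hab.ne]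
  -- `σ` matches the bonds of `s` entering `v` with those leaving it, so each block size is a number
  -- of visits.
  have hcard : ∀ v : Fin V, Fintype.card {a : s // terminus a.1 = v} =
      Fintype.card {a : s // origin a.1 = v} := fun v =>
    Fintype.card_congr (σ.subtypeEquiv fun a => by rw [hσ a])
  rw [hdet, htri.det_fintype]
  congr 1
  have hblock : ∀ v : Fin V, (T.toSquareBlock (fun a : s => terminus a.1) v).det =
      (if Fintype.card {a : s // origin a.1 = v} = 2 then 2 else 1) *
        ∏ a : {a : s // terminus a.1 = v}, bondScattering ν (σ a.1) a.1 := by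
    intro v
    have h1 : T.toSquareBlock (fun a : s => terminus a.1) v =
        Matrix.of fun a b : {a : s // terminus a.1 = v} =>
          dft (ν.outIdx (σ a.1)) (ν.inIdx b.1) := by
      ext a b
      rw [Matrix.toSquareBlock_def, Matrix.of_apply, hT, if_pos (b.2.trans a.2.symm),
        Matrix.of_apply]
    rw [h1, det_dft_block (f := fun a : {a : s // terminus a.1 = v} => ν.outIdx (σ a.1))
      (g := fun a : {a : s // terminus a.1 = v} => ν.inIdx a.1), hcard]
    · congr 1
      refine Finset.prod_congr rfl fun a _ => ?_
      rw [bondScattering, Matrix.of_apply, if_pos (hσ a.1)]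
    · intro a b hab
      refine Subtype.ext (σ.injective (Subtype.ext (ν.outIdx_inj _ _ ?_ hab)))
      rw [← hσ, ← hσ, a.2, b.2]
    · intro a b hab
      exact Subtype.ext (Subtype.ext (ν.inIdx_inj _ _ (a.2.trans b.2.symm) hab))
  simp_rw [hblock]
  rw [Finset.prod_mul_distrib, Finset.prod_ite, Finset.prod_const_one, mul_one, Finset.prod_const]
  congr 1
  exact Fintype.prod_fiberwise (fun a : s => terminus a.1) fun a : s => bondScattering ν (σ a) a

/-- The contribution of a pseudo orbit without repeated bonds. -/
theorem contribution_eq_pow {L : Bond V → ℝ} (hL : LinearIndependent ℚ L) (ν : BondNumbering V)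
    {γ : Finset (Cycle (Bond V))} (hγ : IsPrimitivePseudoOrbit γ) (hnd : (content γ).Nodup) :
    contribution L ν γ = 2 ^ ({v : Fin V | (content γ).countP (origin · = v) = 2} :
      Finset (Fin V)).card * (1 / 2) ^ Multiset.card (content γ) := by
  classical
  have := Fintype.ofFinite (Bond V)
  obtain ⟨σ, hsign, hfix, hprod, hrel⟩ :=
    exists_perm_of_content_nodup (fun c hc => (hγ c hc).1.1) hnd
  have hR := hrel _ fun c hc => (hγ c hc).1.2
  let s : Finset (Bond V) := ⟨content γ, hnd⟩
  have hmem : ∀ b, σ b ∈ s ↔ b ∈ s := by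
    intro b
    constructor
    · intro h
      by_contra hb
      rw [hfix b hb] at h
      exact hb h
    · intro h
      by_contra hb
      rw [σ.injective (hfix _ hb)] at hb
      exact hb h
  let τ : Perm s := σ.subtypePerm hmem
  have hτ : ((Perm.sign τ : ℤ) : ℂ) = (-1) ^ Multiset.card (content γ) * (-1) ^ γ.card := by
    have h : Perm.sign τ = Perm.sign σ := by
      convert Perm.sign_subtypePerm σ hmem fun b hb => by_contra fun h => hb (hfix b h)
    rw [h, hsign]
    simp [pow_add]
  have hA : amplitude ν γ = ∏ a : s, bondScattering ν (τ a) a := by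
    rw [amplitude, hprod]
    exact (Finset.prod_coe_sort s fun b => bondScattering ν (σ b) b).symm
  have hAA : amplitude ν γ * (starRingEnd ℂ) (amplitude ν γ) =
      (1 / 2) ^ Multiset.card (content γ) := by
    rw [hA, map_prod, ← Finset.prod_mul_distrib, Finset.prod_congr rfl (g := fun _ => 1 / 2)]
    · rw [Finset.prod_const, Finset.card_univ, Fintype.card_coe]
      rfl
    · intro a _
      have h : bondScattering ν (τ a) a = dft (ν.outIdx (τ a)) (ν.inIdx a) := if_pos (hR a.1 a.2)
      rw [h, dft_mul_conj]
  have hcount : ∀ v : Fin V, Fintype.card {a : s // origin a.1 = v} =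
      (content γ).countP (origin · = v) := by
    intro v
    rw [Fintype.card_subtype, Multiset.countP_eq_card_filter]
    change _ = (s.filter (origin · = v)).card
    rw [← Finset.card_map (Function.Embedding.subtype _)]
    congr 1
    ext b
    simp only [Finset.mem_map, Finset.mem_univ, true_and, Function.Embedding.subtype_apply,
      Finset.mem_filter]
    exact ⟨fun ⟨a, ha, hab⟩ => hab ▸ ⟨a.2, ha⟩, fun ⟨h1, h2⟩ => ⟨⟨b, h1⟩, h2, rfl⟩⟩
  rw [contribution_eq_det hL ν (s := s) rfl, det_submatrix_bondScattering ν τ fun a => hR a.1 a.2,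
    ← hA, hτ]
  simp_rw [hcount]
  have hs : s.card = Multiset.card (content γ) := rfl
  rw [hs, ← hAA]
  -- The sign of `τ` supplies a second copy of both $(-1)^n$ and $(-1)^{m_{\bar\gamma}}$, so all
  -- signs cancel.
  have hsq : ∀ k : ℕ, ((-1 : ℂ) ^ k) * (-1) ^ k = 1 := fun k => by
    rw [← mul_pow, neg_one_mul, neg_neg, one_pow]
  simp only [map_mul, map_pow, map_neg, map_one, map_ofNat]
  linear_combination (2 ^ ({v : Fin V | (content γ).countP (origin · = v) = 2} :
      Finset (Fin V)).card * (amplitude ν γ * (starRingEnd ℂ) (amplitude ν γ))) *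
    ((-1) ^ γ.card * (-1) ^ γ.card * hsq (Multiset.card (content γ)) + hsq γ.card)

end BinaryGraph

theorem mainTheorem8 (p r : ℕ) (hp : Odd p) (hr : 1 ≤ r)
    (L : BinaryGraph.Bond (p * 2 ^ r) → ℝ) (hLpos : ∀ b, 0 < L b)
    (hL : LinearIndependent ℚ L)
    (ν : BinaryGraph.BondNumbering (p * 2 ^ r))
    (γ : Finset (Cycle (BinaryGraph.Bond (p * 2 ^ r))))
    (hγ : BinaryGraph.IsPrimitivePseudoOrbit γ)
    (n : ℕ) (hn : BinaryGraph.topLength γ = n) :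
    (∀ N : ℕ, 1 ≤ N → (BinaryGraph.encounters γ).encard = N →
      (∀ e ∈ BinaryGraph.encounters γ,
        BinaryGraph.occurrences γ e = 2 ∧ BinaryGraph.encounterLength e = 0) →
      BinaryGraph.contribution L ν γ = (2 : ℂ) ^ ((N : ℤ) - (n : ℤ))) ∧
    ((∃ e ∈ BinaryGraph.encounters γ,
        0 < BinaryGraph.encounterLength e ∨ 3 ≤ BinaryGraph.occurrences γ e) →
      BinaryGraph.contribution L ν γ = 0) := by
  constructor
  · intro N _ hN henc
    -- A repeated bond would produce an encounter with at least two vertices, hence of positive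
    -- length.
    have hnd : (CyclicWord.content γ).Nodup := by
      by_contra h
      obtain ⟨e, he, hlen⟩ := BinaryGraph.exists_encounter_of_not_nodup hγ h
      have := (henc e he).2
      rw [BinaryGraph.encounterLength] at this
      omega
    rw [BinaryGraph.encard_encounters hγ hnd henc] at hN
    rw [BinaryGraph.contribution_eq_pow hL ν hγ hnd, ENat.natCast_inj.1 hN,
      ← BinaryGraph.topLength_eq_card_content, hn, zpow_sub₀ two_ne_zero, zpow_natCast,
      zpow_natCast, one_div, inv_pow, div_eq_mul_inv]
  · rintro ⟨e, he, h⟩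
    refine BinaryGraph.contribution_eq_zero hL ν
      (BinaryGraph.not_nodup_of_occurrences hγ ν he.1 he.2.1 (h.imp_left fun h => ?_))
    rw [BinaryGraph.encounterLength] at h
    omega
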